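/- **Definitions.** Let $\Sigma$ be a finite alphabet, $\#\notin\Sigma$, and let $X=\{x_1,\dots,x_k\}$ be a finite set of word variables. A *context-free hypergrammar* (CFHG) is a tuple $G=\langle\Sigma,X,V,V_0,P,\alpha\rangle$, where $\hat G=\langle\hat\Sigma,V,V_0,P\rangle$ is a context-free grammar over $\hat\Sigma=(\Sigma\cup\{\#\})^X$ and $\alpha=\mathbb Q_1x_1\cdots\mathbb Q_kx_k$, $\mathbb Q_i\in\{\exists,\forall\}$, quantifies each word variable exactly once. It is a $\forall^*$-CFHG if all $\mathbb Q_i$ are $\forall$. For $w\in\Sigma^*$ let $w{\uparrow_\#}$ be the set of words obtained from $w$ by inserting symbols $\#$ at arbitrary places. An assignment $u:X\to(\Sigma\cup\{\#\})^*$ is represented by the word $\boldsymbol w_u\in\hat\Sigma^*$ whose $i$-th letter maps $x$ to the $i$-th letter of $u(x)$, shorter words being padded with $\#$ at the end. For a language $\mathcal L\subseteq\Sigma^*$ put $\mathcal L\vdash_u(\epsilon,\hat G)$ iff $\boldsymbol w_u\in\mathcal L(\hat G)$; $\mathcal L\vdash_u(\exists x.\alpha',\hat G)$ iff there are $w\in\mathcal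 L$ and $w'\in w{\uparrow_\#}$ with $\mathcal L\vdash_{u[x\mapsto w']}(\alpha',\hat G)$; and $\mathcal L\vdash_u(\forall x.\alpha',\hat G)$ iff for every $w\in\mathcal L$ there is $w'\in w{\uparrow_\#}$ with $\mathcal L\vdash_{u[x\mapsto w']}(\alpha',\hat G)$. The grammar $G$ *derives* $\mathcal L$, written $\mathcal L\in\mathfrak L(G)$, if $\mathcal L\vdash_u(\alpha,\hat G)$ (this does not depend on $u$). *Standing assumptions.* Every $v\in V$ derives a terminal word and is reachable from $V_0$ in $\hat G$; there is no rule $v\to\varepsilon$, except possibly $V_0\to\varepsilon$, in which case $V_0$ occurs on no right side of a rule. *Ranks.* The vertices of the rule graph are the grammar variables and the right sides of rules, a variable being identified with the sequence of length one. $E_L$ consists of the edges $v\to w$ for the rules $v\to w$ in $P$ and the edges from a right side $w=v\gamma$ to $v\in V$; $E_R$ consists of the edges $v\to w$ for the rules $v\to w$ in $P$ and the edges from a right side $w=\gamma v$ to $v\in V$. For $d\in\{L,R\}$, the strongly connected components with respect to $E_d$ form an acyclic graph, in which $C\to D$ if $C\ne D$ and some edge of $E_d$ leads from $C$ to $D$.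 The rank of a letter $\sigma\in\hat\Sigma$ is $t(\sigma)=\{x\in X:\sigma(x)=\#\}$. The left ranks $\mathbf L$ and right ranks $\mathbf R$ are defined along these acyclic graphs by $\mathbf L(\sigma\gamma)=t(\sigma)$ and $\mathbf R(\gamma\sigma)=t(\sigma)$ for $\sigma\in\hat\Sigma$, $\mathbf L(\varepsilon)=X$, $\mathbf R(\varepsilon)=\emptyset$, and $$\mathbf L(u)=\bigcap_{u'\in C}\ \bigcap_{C\to D}\ \bigcap_{u''\in D}\mathbf L(u'')\quad\text{for }u=v\gamma\in C,\qquad \mathbf R(u)=\bigcup_{u'\in C}\ \bigcup_{C\to D}\ \bigcup_{u''\in D}\mathbf R(u'')\quad\text{for }u=\gamma v\in C,$$ where $v\in V$ and $C$ is the component of $u$ with respect to $E_L$, respectively $E_R$. The CFHG $G$ is a *synchronous* CFHG (syncCFHG) if it satisfies the standing assumptions and is ranked: for every rule $v\to\gamma_1\cdots\gamma_n$ with $\gamma_i\in\hat\Sigma\cup V$ one has $\mathbf R(\gamma_i)\subseteq\mathbf L(\gamma_{i+1})$ for $1\le i<n$. **Theorem.** The regular membership problem for $\forall^*$-syncCFHG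 is undecidable: there is no algorithm that, given a $\forall^*$-syncCFHG $G$ and a nondeterministic finite automaton $A$ over the same alphabet $\Sigma$ with $\mathcal L(A)\neq\emptyset$, decides whether $\mathcal L(A)\in\mathfrak L(G)$. This holds even if the algorithm is allowed to behave arbitrarily, for instance not to halt, on all other inputs. -/

import Mathlib

namespace HyperCFG

/-- The two kinds of quantifiers of a quantification condition. -/
inductive Quantifier where
  | ex
  | all

/-- A context-free hypergrammar over the alphabet `A`, with set `X` of word variables and set `N`
of grammar variables. The padding symbol `#` is `none : Option A`, so `Option A` is `Σ ∪ {#}` and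
`X → Option A` is the alphabet `(Σ ∪ {#})^X` of the underlying grammar. The finite set of grammar
rules is given as a list, and the quantification condition `Q₁ x₁ ⋯ Qₖ xₖ` quantifies each word
variable exactly once. -/
structure CFHG (A X N : Type) where
  initial : N
  rules : List (ContextFreeRule (X → Option A) N)
  condition : List (Quantifier × X)
  condition_nodup : (condition.map Prod.snd).Nodup
  condition_complete : ∀ x : X, x ∈ condition.map Prod.snd

/-- `paddings w` is the set `w↑#` of the words obtained from `w` by inserting symbols `#` at
arbitrary places, that is, the words that give `w` when all symbols `#` are removed. -/
def paddings {A : Type} (w : List A) : Set (List (Option A)) :=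
  {w' | w'.reduceOption = w}

/-- The word assignment of `u`: its `i`-th letter collects the `i`-th letters of all the words
`u x`, where the shorter words are padded with `#` at the end. -/
def wordAssignment {A X : Type} [Fintype X] (u : X → List (Option A)) : List (X → Option A) :=
  (List.range (Finset.univ.sup fun x => (u x).length)).map fun i x => (u x).getD i none

/-- The acceptance condition `L ⊢_u (α, Ĝ)`. -/
def Satisfies {A X : Type} [Fintype X] [DecidableEq X] (L : Language A)
    (g : ContextFreeGrammar (X → Option A)) :
    List (Quantifier × X) → (X → List (Option A)) → Prop
  | [], u => wordAssignment u ∈ g.language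
  | (Quantifier.ex, x) :: α, u =>
      ∃ w ∈ L, ∃ w' ∈ paddings w, Satisfies L g α (Function.update u x w')
  | (Quantifier.all, x) :: α, u =>
      ∀ w ∈ L, ∃ w' ∈ paddings w, Satisfies L g α (Function.update u x w')

/-- The strongly connected component of the vertex `u` of the directed graph with edges `E`. -/
def component {W : Type} (E : W → W → Prop) (u : W) : Set W :=
  {u' | Relation.ReflTransGen E u u' ∧ Relation.ReflTransGen E u' u}

/-- The edges of the acyclic graph of strongly connected components: an edge of the directed graph
leads from `C` to a different component `D`. -/
def ComponentEdge {W : Type} (E : W → W → Prop) (C D : Set W) : Prop :=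
  C ≠ D ∧ ∃ u ∈ C, ∃ u' ∈ D, E u u'

/-- `letterRank σ` is the set of the word variables to which the letter `σ` assigns `#`. -/
def letterRank {A X : Type} (σ : X → Option A) : Set X :=
  {x | σ x = none}

namespace CFHG

variable {A X N : Type}

open Classical in
/-- The underlying context-free grammar. -/
noncomputable def underlying (G : CFHG A X N) : ContextFreeGrammar (X → Option A) where
  NT := N
  initial := G.initial
  rules := G.rules.toFinset

/-- The hyperlanguage of `G`: the set of all languages that `G` derives. As the condition quantifies
all word variables, the assignment one starts with is irrelevant. -/
def hyperlanguage [Fintype X] [DecidableEq X] (G : CFHG A X N) : Set (Language A) :=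
  {L | Satisfies L G.underlying G.condition fun _ => []}

/-- `G` is a `∀*`-grammar: all quantifiers are universal. -/
def IsUniversal (G : CFHG A X N) : Prop :=
  ∀ q ∈ G.condition, q.1 = Quantifier.all

/-- Sequences of letters of `(Σ ∪ {#})^X` and of grammar variables. -/
abbrev Sentence (A X N : Type) : Type := List (Symbol (X → Option A) N)

/-- The vertices of the rule graph: the grammar variables (as sequences of length one) and the
right sides of the rules. -/
def vertices (G : CFHG A X N) : Set (Sentence A X N) :=
  {u | ∃ v : N, u = [Symbol.nonterminal v]} ∪ {u | ∃ r ∈ G.rules, u = r.output}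

/-- The edges `E_L`: from `v` to `w` for each rule `v → w`, and from a right side `v γ` to its
first symbol `v` if this is a grammar variable. -/
def LeftEdge (G : CFHG A X N) (u w : Sentence A X N) : Prop :=
  (∃ r ∈ G.rules, u = [Symbol.nonterminal r.input] ∧ w = r.output) ∨
  (∃ r ∈ G.rules, ∃ v γ, r.output = Symbol.nonterminal v :: γ ∧ u = r.output ∧
    w = [Symbol.nonterminal v])

/-- The edges `E_R`: from `v` to `w` for each rule `v → w`, and from a right side `γ v` to its
last symbol `v` if this is a grammar variable. -/
def RightEdge (G : CFHG A X N) (u w : Sentence A X N) : Prop :=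
  (∃ r ∈ G.rules, u = [Symbol.nonterminal r.input] ∧ w = r.output) ∨
  (∃ r ∈ G.rules, ∃ v γ, r.output = γ ++ [Symbol.nonterminal v] ∧ u = r.output ∧
    w = [Symbol.nonterminal v])

/-- The auxiliary set `l(u)`, computed from the left ranks `L` in the components that directly
follow the component of `u`. -/
def auxLeft (G : CFHG A X N) (L : Sentence A X N → Set X) (u : Sentence A X N) : Set X :=
  ⋂ D ∈ {D : Set (Sentence A X N) | (∃ d ∈ G.vertices, D = component G.LeftEdge d) ∧
    ComponentEdge G.LeftEdge (component G.LeftEdge u) D}, ⋂ u' ∈ D, L u'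

/-- The auxiliary set `r(u)`, computed from the right ranks `R` in the components that directly
follow the component of `u`. -/
def auxRight (G : CFHG A X N) (R : Sentence A X N → Set X) (u : Sentence A X N) : Set X :=
  ⋃ D ∈ {D : Set (Sentence A X N) | (∃ d ∈ G.vertices, D = component G.RightEdge d) ∧
    ComponentEdge G.RightEdge (component G.RightEdge u) D}, ⋃ u' ∈ D, R u'

/-- `L` assigns to the vertices of the rule graph their left ranks. The equations determine `L` on
the vertices and on the letters, by recursion along the finite acyclic graph of components. -/
structure IsLeftRank (G : CFHG A X N) (L : Sentence A X N → Set X) : Prop where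
  of_nil : L [] = Set.univ
  of_letter : ∀ σ γ, L (Symbol.terminal σ :: γ) = letterRank σ
  of_nonterminal : ∀ v γ, Symbol.nonterminal v :: γ ∈ G.vertices →
    L (Symbol.nonterminal v :: γ) =
      ⋂ u' ∈ component G.LeftEdge (Symbol.nonterminal v :: γ), G.auxLeft L u'

/-- `R` assigns to the vertices of the rule graph their right ranks. The equations determine `R` on
the vertices and on the letters, by recursion along the finite acyclic graph of components. -/
structure IsRightRank (G : CFHG A X N) (R : Sentence A X N → Set X) : Prop where
  of_nil : R [] = ∅
  of_letter : ∀ σ γ, R (γ ++ [Symbol.terminal σ]) = letterRank σ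
  of_nonterminal : ∀ v γ, γ ++ [Symbol.nonterminal v] ∈ G.vertices →
    R (γ ++ [Symbol.nonterminal v]) =
      ⋃ u' ∈ component G.RightEdge (γ ++ [Symbol.nonterminal v]), G.auxRight R u'

/-- `G` is ranked: for any two consecutive symbols `a b` of the right side of a rule, the right rank
of `a` is contained in the left rank of `b`. -/
def IsRanked (G : CFHG A X N) : Prop :=
  ∃ L R : Sentence A X N → Set X, G.IsLeftRank L ∧ G.IsRightRank R ∧
    ∀ r ∈ G.rules, r.output.IsChain fun a b => R [a] ⊆ L [b]

/-- The standing assumptions on the underlying grammar: each grammar variable derives a terminal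
word and is reachable from the initial variable, and there is no rule `v → ε` except possibly
`V₀ → ε`, in which case `V₀` does not occur on the right side of a rule. -/
structure IsReduced (G : CFHG A X N) : Prop where
  productive : ∀ v : N, ∃ w : List (X → Option A),
    G.underlying.Derives [Symbol.nonterminal v] (w.map Symbol.terminal)
  reachable : ∀ v : N, ∃ p q : Sentence A X N,
    G.underlying.Derives [Symbol.nonterminal G.initial] (p ++ [Symbol.nonterminal v] ++ q)
  empty_rule : ∀ r ∈ G.rules, r.output = [] →
    r.input = G.initial ∧ ∀ r' ∈ G.rules, Symbol.nonterminal G.initial ∉ r'.output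

/-- Synchronous context-free hypergrammars. -/
def IsSync (G : CFHG A X N) : Prop :=
  G.IsReduced ∧ G.IsRanked

end CFHG

/-- A nondeterministic finite automaton given by finite lists of transitions, of initial states and
of accepting states. -/
structure FiniteNFA (A S : Type) where
  transitions : List (S × A × S)
  start : List S
  accept : List S

/-- The automaton as an `NFA`. -/
def FiniteNFA.toNFA {A S : Type} (M : FiniteNFA A S) : NFA A S where
  step q a := {q' | (q, a, q') ∈ M.transitions}
  start := {q | q ∈ M.start}
  accept := {q | q ∈ M.accept}

/-- An input of the regular membership problem: a hypergrammar and an automaton for the regular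
language, over a common finite alphabet. -/
structure MembershipInput where
  numLetters : ℕ
  numWordVars : ℕ
  numGrammarVars : ℕ
  numStates : ℕ
  grammar : CFHG (Fin numLetters) (Fin numWordVars) (Fin numGrammarVars)
  automaton : FiniteNFA (Fin numLetters) (Fin numStates)

/-- The regular language of an input. -/
def MembershipInput.language (I : MembershipInput) : Language (Fin I.numLetters) :=
  I.automaton.toNFA.accepts

/-- The finite strings of numbers that algorithms read: the four sizes, the initial variable, the
rules, the quantification condition, and the transitions, initial states and accepting states. -/
abbrev Code : Type :=
  (ℕ × ℕ × ℕ × ℕ) ×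
  (ℕ × List (ℕ × List (List (Option ℕ) ⊕ ℕ)) × List (Bool × ℕ)) ×
  (List (ℕ × ℕ × ℕ) × List ℕ × List ℕ)

/-- The code of a symbol: a letter of `(Σ ∪ {#})^X` is written as the list of its components. -/
def encodeSymbol {s k n : ℕ} :
    Symbol (Fin k → Option (Fin s)) (Fin n) → List (Option ℕ) ⊕ ℕ
  | Symbol.terminal σ => Sum.inl (List.ofFn fun i => (σ i).map Fin.val)
  | Symbol.nonterminal v => Sum.inr v.val

/-- The code of a quantifier. -/
def encodeQuantifier : Quantifier → Bool
  | Quantifier.ex => false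
  | Quantifier.all => true

/-- The code of an input. -/
def MembershipInput.encode (I : MembershipInput) : Code :=
  ((I.numLetters, I.numWordVars, I.numGrammarVars, I.numStates),
   (I.grammar.initial.val,
    I.grammar.rules.map fun r => (r.input.val, r.output.map encodeSymbol),
    I.grammar.condition.map fun q => (encodeQuantifier q.1, q.2.val)),
   (I.automaton.transitions.map fun t => (t.1.val, t.2.1.val, t.2.2.val),
    I.automaton.start.map Fin.val,
    I.automaton.accept.map Fin.val))

/-- The regular membership problem is decidable on the class `P` of inputs: some algorithm, given
the code of an input in `P`, halts with the correct answer to the question whether the regular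
language belongs to the hyperlanguage. Nothing is required of the algorithm on anything else. -/
def RegularMembershipDecidable (P : MembershipInput → Prop) : Prop :=
  ∃ f : Code →. Bool, Partrec f ∧ ∀ I : MembershipInput, P I →
    (I.language ∈ I.grammar.hyperlanguage → true ∈ f I.encode) ∧
    (I.language ∉ I.grammar.hyperlanguage → false ∈ f I.encode)

end HyperCFG

/-! The halting problem reduces to membership. A counter program is a regular expression over the
instructions "increment", "decrement" and "test for zero". A sequence of instructions is executable
if no decrement meets a zero counter and no test meets a positive one. For each partial recursive
`f` there is a program `P` such that `f n` is defined iff some word of `P`, preceded by `n`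
increments of counter `0`, is executable from the all-zero state (`exists_program_of_partrec`). The
argument enters only through this prefix, so `P` and its number of counters do not depend on `n`.

Executability constrains all counters at once, but failure can be blamed on one instruction and one
counter `x`, so the sequences that fail form a context-free language. If a word that does not change
`x` in total is followed by a decrement of `x`, then the sequence fails from the zero state. If an
increment of `x`, a word that does not change `x` and a test of `x` follow one another, then the
sequence fails from any state. Conversely, the first failure of a sequence always has one of these
two shapes. Both use only a balance condition on a single counter
(`sentenceLanguage_varLanguage_le`, `mem_start_of_run_eq_none`).

With a single universally quantified word variable and no padding symbol in the letters, the
hypergrammar derives `L` iff all words of `L` fail (`mem_hyperlanguage_failureGrammar`), and it is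
ranked because all ranks at variables are empty (`isRanked_of_letterRank_eq_empty`). Applied to the
regular language of the prefixed words of `P`, membership says that `f n` is undefined. The
automaton is computable from `n`, so an algorithm for membership would decide halting. -/

namespace CounterProgram

/-! ### Counter programs and their execution -/

open Relation

/-- The operations on a counter: increment, decrement of a positive counter, test for zero. -/
inductive Op where
  | inc
  | dec
  | zero
  deriving DecidableEq

instance : Fintype Op where
  elems := {Op.inc, Op.dec, Op.zero}
  complete := by rintro ⟨⟩ <;> simp

/-- An instruction applies an operation to the counter with the given number. -/
abbrev Instr : Type := ℕ × Op

/-- The effect of an instruction on the values of the counters, if it can be executed. -/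
def step (s : ℕ → ℕ) : Instr → Option (ℕ → ℕ)
  | (x, Op.inc) => some (Function.update s x (s x + 1))
  | (x, Op.dec) => if s x = 0 then none else some (Function.update s x (s x - 1))
  | (x, Op.zero) => if s x = 0 then some s else none

/-- The effect of a sequence of instructions. -/
def run (s : ℕ → ℕ) : List Instr → Option (ℕ → ℕ)
  | [] => some s
  | a :: w => (step s a).bind fun s' => run s' w

theorem run_append (s : ℕ → ℕ) (u w : List Instr) :
    run s (u ++ w) = (run s u).bind fun s' => run s' w := by
  induction u generalizing s with
  | nil => rfl
  | cons a u ih =>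
    simp only [List.cons_append, run, Option.bind_assoc]
    congr 1
    funext m
    exact ih m

/-- A program is a regular expression; it may execute any of the matching sequences. -/
abbrev Program : Type := RegularExpression Instr

/-- The relation between the counter values before and after an execution of a program. -/
def Run (P : Program) (s s' : ℕ → ℕ) : Prop :=
  ∃ w ∈ P.matches', run s w = some s'

theorem run_one {s s' : ℕ → ℕ} : Run 1 s s' ↔ s' = s := by
  simp [Run, Language.mem_one, run, eq_comm]

theorem run_mul {P Q : Program} {s s' : ℕ → ℕ} :
    Run (P * Q) s s' ↔ ∃ m, Run P s m ∧ Run Q m s' := by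
  simp only [Run, RegularExpression.matches'_mul, Language.mem_mul]
  constructor
  · rintro ⟨_, ⟨u, hu, v, hv, rfl⟩, h⟩
    rw [run_append, Option.bind_eq_some_iff] at h
    obtain ⟨m, h₁, h₂⟩ := h
    exact ⟨m, ⟨u, hu, h₁⟩, v, hv, h₂⟩
  · rintro ⟨m, ⟨u, hu, h₁⟩, v, hv, h₂⟩
    exact ⟨_, ⟨u, hu, v, hv, rfl⟩, by simp [run_append, h₁, h₂]⟩

theorem run_star {P : Program} {s s' : ℕ → ℕ} :
    Run P.star s s' ↔ ReflTransGen (Run P) s s' := by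
  simp only [Run, RegularExpression.matches'_star, Language.mem_kstar]
  constructor
  · rintro ⟨_, ⟨l, rfl, hl⟩, h⟩
    induction l generalizing s with
    | nil =>
      simp only [List.flatten_nil, run, Option.some.injEq] at h
      exact h ▸ .refl
    | cons u l ih =>
      rw [List.flatten_cons, run_append, Option.bind_eq_some_iff] at h
      obtain ⟨m, h₁, h₂⟩ := h
      exact .head ⟨u, hl u (by simp), h₁⟩ (ih (fun y hy => hl y (by simp [hy])) h₂)
  · intro h
    induction h using ReflTransGen.head_induction_on with
    | refl => exact ⟨_, ⟨[], rfl, by simp⟩, rfl⟩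
    | head h₁ _ ih =>
      obtain ⟨u, hu, h₁⟩ := h₁
      obtain ⟨_, ⟨l, rfl, hl⟩, h₂⟩ := ih
      exact ⟨_, ⟨u :: l, rfl, by simpa [hu] using hl⟩, by simp [run_append, h₁, h₂]⟩

/-- Increment the counter `x`. -/
def inc (x : ℕ) : Program := RegularExpression.char (x, Op.inc)

/-- Decrement the counter `x`, which must be positive. -/
def dec (x : ℕ) : Program := RegularExpression.char (x, Op.dec)

/-- Check that the counter `x` is zero. -/
def zero (x : ℕ) : Program := RegularExpression.char (x, Op.zero)

theorem run_char {a : Instr} {s s' : ℕ → ℕ} :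
    Run (RegularExpression.char a) s s' ↔ step s a = some s' := by
  simp only [Run, RegularExpression.matches'_char]
  constructor
  · rintro ⟨w, rfl, h⟩
    simpa [run] using h
  · intro h
    exact ⟨[a], rfl, by simp [run, h]⟩

theorem run_inc {x : ℕ} {s s' : ℕ → ℕ} :
    Run (inc x) s s' ↔ s' = Function.update s x (s x + 1) := by
  simp [inc, run_char, step, eq_comm]

theorem run_dec {x : ℕ} {s s' : ℕ → ℕ} :
    Run (dec x) s s' ↔ s x ≠ 0 ∧ s' = Function.update s x (s x - 1) := by
  simp [dec, run_char, step, eq_comm]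

theorem run_zero {x : ℕ} {s s' : ℕ → ℕ} : Run (zero x) s s' ↔ s x = 0 ∧ s' = s := by
  simp [zero, run_char, step, eq_comm]

/-- Set the counter `x` to zero. -/
def clear (x : ℕ) : Program := (dec x).star * zero x

/-- A loop `Q.star * zero x` acts as "while `x` is positive do `Q`" when `Q` decrements `x`: the
star may stop too early, but the test then blocks the run. All later loops over a counter use this
device. -/
theorem run_clear {x : ℕ} {s s' : ℕ → ℕ} : Run (clear x) s s' ↔ s' = Function.update s x 0 := by
  rw [clear, run_mul]
  simp only [run_star, run_zero]
  constructor
  · rintro ⟨m, hm, h0, rfl⟩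
    have : ∀ z, z ≠ x → s' z = s z := by
      clear h0
      induction hm with
      | refl => simp
      | tail _ h ih =>
        intro z hz
        rw [run_dec] at h
        rw [h.2, Function.update_of_ne hz, ih z hz]
    funext z
    by_cases hz : z = x
    · simp [hz, h0]
    · simp [hz, this z hz]
  · rintro rfl
    refine ⟨_, ?_, by simp, rfl⟩
    generalize hn : s x = n
    induction n generalizing s with
    | zero => rw [← hn, Function.update_eq_self]
    | succ n ih =>
      refine .head (run_dec.2 ⟨by omega, rfl⟩) ?_
      have := ih (s := Function.update s x (s x - 1)) (by simp [hn])
      simpa using this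

/-- Copy the counter `x` to the counter `y` by means of the auxiliary counter `t`. -/
def copy (x y t : ℕ) : Program :=
  clear y * (clear t * ((dec x * (inc y * inc t)).star * (zero x *
    ((dec t * inc x).star * zero t))))

theorem run_copy {x y t : ℕ} (hxy : x ≠ y) (hxt : x ≠ t) (hyt : y ≠ t) {s s' : ℕ → ℕ} :
    Run (copy x y t) s s' ↔ s' = Function.update (Function.update s y (s x)) t 0 := by
  rw [copy]
  simp only [run_mul, run_clear, run_zero, run_star]
  constructor
  · rintro ⟨_, rfl, m, rfl, _, h₁, m₁, ⟨hx, rfl⟩, m₂, h₂, ht, rfl⟩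
    -- The first loop moves `x` into `y` and `t` together; the second moves `t` back into `x`. The
    -- sum of `x` and `t` is invariant in both.
    have i₁ : m₁ x + m₁ t = s x ∧ m₁ y = m₁ t ∧
        ∀ z, z ≠ x → z ≠ y → z ≠ t → m₁ z = s z := by
      clear h₂ hx
      induction h₁ with
      | refl =>
        refine ⟨?_, ?_, fun z h h' h'' => ?_⟩ <;> simp [*]
      | tail _ h ih =>
        simp only [run_mul, run_dec, run_inc] at h
        obtain ⟨_, ⟨h0, rfl⟩, _, rfl, rfl⟩ := h
        obtain ⟨e₁, e₂, e₃⟩ := ih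
        refine ⟨?_, ?_, fun z h h' h'' => ?_⟩
        · simp only [Function.update_apply]; grind
        · simp [hyt, hxt.symm, hyt.symm, hxy.symm, e₂]
        · simp [h, h', h'', e₃]
    have i₂ : s' x + s' t = s x ∧ s' y = s x ∧ ∀ z, z ≠ x → z ≠ y → z ≠ t → s' z = s z := by
      clear ht
      induction h₂ with
      | refl => exact ⟨i₁.1, by omega, i₁.2.2⟩
      | tail _ h ih =>
        simp only [run_mul, run_dec, run_inc] at h
        obtain ⟨_, ⟨h0, rfl⟩, rfl⟩ := h
        obtain ⟨e₁, e₂, e₃⟩ := ih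
        refine ⟨?_, ?_, fun z h h' h'' => ?_⟩
        · simp [*, hxt.symm]; omega
        · simp [hyt, hxy.symm, e₂]
        · simp [h, h'', e₃ z h h' h'']
    obtain ⟨e₁, e₂, e₃⟩ := i₂
    funext z
    by_cases h'' : z = t
    · simp [h'', ht]
    by_cases h' : z = y
    · subst h'; simp [h'', e₂]
    by_cases h : z = x
    · subst h; simp [h', h'']; omega
    · simp [h', h'', e₃ z h h' h'']
  · rintro rfl
    have l₁ : ∀ n (m : ℕ → ℕ), m x = n → ReflTransGen (Run (dec x * (inc y * inc t))) m
        (Function.update (Function.update (Function.update m x 0) y (m y + n)) t (m t + n)) := by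
      intro n
      induction n with
      | zero =>
        intro m hm
        have : Function.update (Function.update (Function.update m x 0) y (m y + 0)) t (m t + 0) =
            m := by
          funext z; simp only [Function.update_apply]; grind
        rw [this]
      | succ n ih =>
        intro m hm
        refine .head (run_mul.2 ⟨_, run_dec.2 ⟨by omega, rfl⟩, run_mul.2
          ⟨_, run_inc.2 rfl, run_inc.2 rfl⟩⟩) ?_
        convert ih _ ?_ using 1
        · funext z; simp only [Function.update_apply]; grind
        · simp [hxy, hxt, hm]
    have l₂ : ∀ n (m : ℕ → ℕ), m t = n → ReflTransGen (Run (dec t * inc x)) m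
        (Function.update (Function.update m t 0) x (m x + n)) := by
      intro n
      induction n with
      | zero =>
        intro m hm
        have : Function.update (Function.update m t 0) x (m x + 0) = m := by
          funext z; simp only [Function.update_apply]; grind
        rw [this]
      | succ n ih =>
        intro m hm
        refine .head (run_mul.2 ⟨_, run_dec.2 ⟨by omega, rfl⟩, run_inc.2 rfl⟩) ?_
        convert ih _ ?_ using 1
        · funext z; simp only [Function.update_apply]; grind
        · simp [hxt.symm, hm]
    refine ⟨_, rfl, _, rfl, _, l₁ _ _ rfl, _, ⟨?_, rfl⟩, _, l₂ _ _ rfl, ?_, ?_⟩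
    · simp [*]
    · simp [*, hxt.symm]
    · funext z; simp only [Function.update_apply]; grind

/-! ### Counter programs compute all partial recursive functions -/

/-- Programs can compute `f`: whatever the counters `xs` of the arguments and the counter `y` of the
result below `b` are, some program changes no counter below `b` except `y`, can only end with a
value of `f` in `y`, and can end if there is such a value. -/
def Implementable {n : ℕ} (f : List.Vector ℕ n →. ℕ) : Prop :=
  ∀ (xs : Fin n → ℕ) (y b : ℕ), (∀ i, xs i < b) → y < b → (∀ i, xs i ≠ y) →
    ∃ P : Program, ∀ s,
      (∀ s', Run P s s' → s' y ∈ f (List.Vector.ofFn fun i => s (xs i)) ∧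
        ∀ z < b, z ≠ y → s' z = s z) ∧
      ((f (List.Vector.ofFn fun i => s (xs i))).Dom → ∃ s', Run P s s')

theorem implementable_zero : Implementable (n := 0) (fun _ => Part.some 0) := by
  intro xs y b _ _ _
  refine ⟨clear y, fun s => ⟨fun s' h => ?_, fun _ => ⟨_, run_clear.2 rfl⟩⟩⟩
  rw [run_clear.1 h]
  exact ⟨by simp, fun z _ hz => by simp [hz]⟩

theorem implementable_get {n : ℕ} (i : Fin n) :
    Implementable (n := n) (fun v => Part.some (v.get i)) := by
  intro xs y b hx hy hxy
  have hr := fun s s' => run_copy (hxy i) (hx i).ne hy.ne (s := s) (s' := s')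
  refine ⟨copy (xs i) y b, fun s => ⟨fun s' h => ?_, fun _ => ⟨_, (hr _ _).2 rfl⟩⟩⟩
  rw [(hr _ _).1 h]
  exact ⟨by simp [hy.ne], fun z h hz => by simp [hz, h.ne]⟩

theorem implementable_succ : Implementable (n := 1) (fun v => Part.some v.head.succ) := by
  intro xs y b hx hy hxy
  have hr := fun s s' => run_copy (hxy 0) (hx 0).ne hy.ne (s := s) (s' := s')
  refine ⟨copy (xs 0) y b * inc y, fun s => ⟨fun s' h => ?_, fun _ => ⟨_, run_mul.2
    ⟨_, (hr _ _).2 rfl, run_inc.2 rfl⟩⟩⟩⟩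
  obtain ⟨m, h₁, h₂⟩ := run_mul.1 h
  rw [run_inc.1 h₂, (hr _ _).1 h₁]
  exact ⟨by simp [hy.ne, List.Vector.ofFn], fun z h hz => by simp [hz, h.ne]⟩

theorem mem_mOfFn {n : ℕ} {α : Type} {f : Fin n → Part α} {v : List.Vector α n} :
    v ∈ List.Vector.mOfFn f ↔ ∀ i, v.get i ∈ f i := by
  induction n with
  | zero => simp [List.Vector.mOfFn, List.Vector.eq_nil v]
  | succ n ih =>
    simp only [List.Vector.mOfFn, Part.bind_eq_bind, Part.mem_bind_iff, Part.pure_eq_some,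
      Part.mem_some_iff, Fin.forall_fin_succ, ih]
    constructor
    · rintro ⟨a, ha, u, hu, rfl⟩
      simpa using ⟨ha, hu⟩
    · rintro ⟨h₁, h₂⟩
      refine ⟨v.head, by simpa using h₁, v.tail, fun i => by simpa using h₂ i, by simp⟩

/-- The values of the inner functions go to the counters `b`, ..., `b + n - 1`. Raising the bound to
`b + n` protects them from the later programs, and the arguments below `b` stay intact throughout.
-/
theorem Implementable.comp {m n : ℕ} {f : List.Vector ℕ n →. ℕ}
    {g : Fin n → List.Vector ℕ m →. ℕ} (hf : Implementable f) (hg : ∀ i, Implementable (g i)) :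
    Implementable fun v => (List.Vector.mOfFn fun i => g i v) >>= f := by
  intro xs y b hx hy hxy
  have args : ∀ j ≤ n, ∃ P : Program, ∀ s,
      (∀ s', Run P s s' → (∀ i : Fin n, (i : ℕ) < j →
          s' (b + i) ∈ g i (List.Vector.ofFn fun i => s (xs i))) ∧ ∀ z < b, s' z = s z) ∧
      ((∀ i : Fin n, (g i (List.Vector.ofFn fun i => s (xs i))).Dom) → ∃ s', Run P s s') := by
    intro j hj
    induction j with
    | zero =>
      refine ⟨1, fun s => ⟨fun s' h => ?_, fun _ => ⟨_, run_one.2 rfl⟩⟩⟩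
      rw [run_one.1 h]
      exact ⟨by simp, by simp⟩
    | succ j ih =>
      obtain ⟨P, hP⟩ := ih (by omega)
      obtain ⟨Q, hQ⟩ := hg ⟨j, hj⟩ xs (b + j) (b + n) (fun i => by have := hx i; omega) (by omega)
        (fun i => by have := hx i; omega)
      have key : ∀ s s', Run P s s' → (List.Vector.ofFn fun i => s' (xs i)) =
          List.Vector.ofFn fun i => s (xs i) := by
        intro s s' h
        congr 1
        funext i
        exact ((hP s).1 s' h).2 _ (hx i)
      refine ⟨P * Q, fun s => ⟨fun s' h => ?_, fun h => ?_⟩⟩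
      · obtain ⟨m, h₁, h₂⟩ := run_mul.1 h
        have e₁ := (hP s).1 m h₁
        have e₂ := (hQ m).1 s' h₂
        rw [key s m h₁] at e₂
        refine ⟨fun i hi => ?_, fun z hz => ?_⟩
        · rcases Nat.lt_succ_iff_lt_or_eq.1 hi with hi | rfl
          · rw [e₂.2 (b + i) (by omega) (by omega)]
            exact e₁.1 i hi
          · exact e₂.1
        · rw [e₂.2 z (by omega) (by omega), e₁.2 z hz]
      · obtain ⟨m, h₁⟩ := (hP s).2 h
        obtain ⟨s', h₂⟩ := (hQ m).2 (by rw [key s m h₁]; exact h _)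
        exact ⟨s', run_mul.2 ⟨m, h₁, h₂⟩⟩
  obtain ⟨P, hP⟩ := args n le_rfl
  obtain ⟨Q, hQ⟩ := hf (fun i => b + i) y (b + n) (fun i => by omega) (by omega)
    (fun i => by omega)
  have key : ∀ s s', Run P s s' → (List.Vector.ofFn fun i : Fin n => s' (b + i)) ∈
      List.Vector.mOfFn fun i => g i (List.Vector.ofFn fun i => s (xs i)) := by
    intro s s' h
    rw [mem_mOfFn]
    intro i
    simpa using ((hP s).1 s' h).1 i i.2
  refine ⟨P * Q, fun s => ⟨fun s' h => ?_, fun h => ?_⟩⟩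
  · obtain ⟨m, h₁, h₂⟩ := run_mul.1 h
    have e₂ := (hQ m).1 s' h₂
    exact ⟨Part.mem_bind_iff.2 ⟨_, key s m h₁, e₂.1⟩, fun z hz hzy => by
      rw [e₂.2 z (by omega) hzy, ((hP s).1 m h₁).2 z hz]⟩
  · obtain ⟨r, hr⟩ := Part.dom_iff_mem.1 h
    obtain ⟨v, hv, hr⟩ := Part.mem_bind_iff.1 hr
    obtain ⟨m, h₁⟩ := (hP s).2 fun i => Part.dom_iff_mem.2 ⟨_, mem_mOfFn.1 hv i⟩
    obtain ⟨s', h₂⟩ := (hQ m).2 (by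
      rw [Part.mem_unique (key s m h₁) hv]
      exact Part.dom_iff_mem.2 ⟨r, hr⟩)
    exact ⟨s', run_mul.2 ⟨m, h₁, h₂⟩⟩

theorem Implementable.prec {n : ℕ} {f : List.Vector ℕ n → ℕ} {g : List.Vector ℕ (n + 2) → ℕ}
    (hf : Implementable fun v => Part.some (f v)) (hg : Implementable fun v => Part.some (g v)) :
    Implementable fun v : List.Vector ℕ (n + 1) => Part.some
      (v.head.rec (f v.tail) fun y IH => g (y ::ᵥ IH ::ᵥ v.tail) : ℕ) := by
  intro xs y b hx hy hxy
  obtain ⟨F, hF⟩ := hf (fun i => xs i.succ) (b + 2) (b + 5)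
    (fun i => by have := hx i.succ; omega) (by omega) (fun i => by have := hx i.succ; omega)
  obtain ⟨G, hG⟩ := hg (Fin.cons (b + 1) (Fin.cons (b + 2) fun i => xs i.succ)) (b + 3) (b + 5)
    (by
      refine Fin.cases (by simp) (Fin.cases (by simp) fun i => ?_)
      have := hx i.succ
      simp only [Fin.cons_succ]; omega) (by omega)
    (by
      refine Fin.cases (by simp) (Fin.cases (by simp) fun i => ?_)
      have := hx i.succ
      simp only [Fin.cons_succ]; omega)
  have hc₁ := fun s s' => run_copy (x := xs 0) (y := b) (t := b + 4) (by have := hx 0; omega)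
    (by have := hx 0; omega) (by omega) (s := s) (s' := s')
  have hc₂ := fun s s' => run_copy (x := b + 3) (y := b + 2) (t := b + 4) (by omega)
    (by omega) (by omega) (s := s) (s' := s')
  have hc₃ := fun s s' => run_copy (x := b + 2) (y := y) (t := b + 4) (by omega)
    (by omega) (by omega) (s := s) (s' := s')
  -- Counter `b` holds the number of remaining rounds, `b + 1` the recursion index, `b + 2` the
  -- current value and `b + 3` the next value; `b + 4` is scratch space for copying. The bound `b +
  -- 5` keeps `F` and `G` away from all of them except their results.
  set body : Program := dec b * (G * (copy (b + 3) (b + 2) (b + 4) * inc (b + 1))) with hbody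
  have body_spec : ∀ m m', Run body m m' → m b = m' b + 1 ∧ m' (b + 1) = m (b + 1) + 1 ∧
      m' (b + 2) = g (m (b + 1) ::ᵥ m (b + 2) ::ᵥ List.Vector.ofFn fun i => m (xs i.succ)) ∧
      ∀ z < b, m' z = m z := by
    intro m m' h
    rw [hbody, run_mul] at h
    obtain ⟨m₁, h₁, h⟩ := h
    rw [run_mul] at h
    obtain ⟨m₂, h₂, h⟩ := h
    rw [run_mul] at h
    obtain ⟨m₃, h₃, h⟩ := h
    rw [run_inc] at h
    rw [run_dec] at h₁
    rw [hc₂] at h₃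
    obtain ⟨e, e'⟩ := (hG m₁).1 m₂ h₂
    obtain ⟨h₁, rfl⟩ := h₁
    have hv : (fun i : Fin n => Function.update m b (m b - 1) (xs i.succ)) =
        fun i => m (xs i.succ) := by
      funext i
      rw [Function.update_of_ne (hx i.succ).ne]
    simp only [List.Vector.ofFn, Fin.cons_zero, Fin.cons_succ, Part.mem_some_iff, hv,
      Function.update_of_ne (show b + 1 ≠ b by omega),
      Function.update_of_ne (show b + 2 ≠ b by omega)] at e
    subst h h₃
    refine ⟨?_, ?_, ?_, fun z hz => ?_⟩
    · simp [e' b (by omega) (by omega)]; omega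
    · simp [e' (b + 1) (by omega) (by omega)]
    · simp [e]
    · have := e' z (by omega) (by omega)
      simp only [Function.update_apply] at this ⊢
      grind
  have body_total : ∀ m : ℕ → ℕ, m b ≠ 0 → ∃ m', Run body m m' := by
    intro m hm
    obtain ⟨m₂, h₂⟩ := (hG (Function.update m b (m b - 1))).2 trivial
    exact ⟨_, run_mul.2 ⟨_, run_dec.2 ⟨hm, rfl⟩, run_mul.2 ⟨m₂, h₂, run_mul.2
      ⟨_, (hc₂ _ _).2 rfl, run_inc.2 rfl⟩⟩⟩⟩
  refine ⟨copy (xs 0) b (b + 4) * (clear (b + 1) * (F * (body.star * (zero b *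
    copy (b + 2) y (b + 4))))), fun s => ⟨fun s' h => ?_, fun _ => ?_⟩⟩
  · simp only [run_mul, hc₁, run_clear, run_star, run_zero, hc₃] at h
    obtain ⟨m₀, h₀, m₁, h₁, m₂, h₂, _, h₃, m₃, ⟨hz, rfl⟩, rfl⟩ := h
    obtain ⟨e, e'⟩ := (hF m₁).1 m₂ h₂
    have hm₁ : (∀ z < b, m₁ z = s z) ∧ m₁ b = s (xs 0) ∧ m₁ (b + 1) = 0 := by
      subst h₀ h₁
      refine ⟨fun z hz => ?_, ?_, ?_⟩
      · simp only [Function.update_apply]; grind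
      · simp
      · simp
    have hv : (List.Vector.ofFn fun i : Fin n => m₁ (xs i.succ)) =
        List.Vector.ofFn fun i => s (xs i.succ) := by
      congr 1
      funext i
      exact hm₁.1 _ (hx _)
    rw [hv, Part.mem_some_iff] at e
    -- Remaining rounds and index add up to the recursion argument, so the final test of `b` forces
    -- the index to be that argument.
    have inv : (∀ z < b, m₃ z = s z) ∧ m₃ b + m₃ (b + 1) = s (xs 0) ∧
        m₃ (b + 2) = Nat.rec (f (List.Vector.ofFn fun i => s (xs i.succ)))
          (fun y IH => g (y ::ᵥ IH ::ᵥ List.Vector.ofFn fun i => s (xs i.succ)))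
          (m₃ (b + 1)) := by
      clear hz
      induction h₃ with
      | refl =>
        refine ⟨fun z hz => ?_, ?_, ?_⟩
        · rw [e' z (by omega) (by omega), hm₁.1 z hz]
        · rw [e' b (by omega) (by omega), e' (b + 1) (by omega) (by omega), hm₁.2.1, hm₁.2.2,
            Nat.add_zero]
        · rw [e' (b + 1) (by omega) (by omega), hm₁.2.2]
          exact e
      | tail _ h ih =>
        obtain ⟨i₁, i₂, i₃⟩ := ih
        obtain ⟨j₁, j₂, j₃, j₄⟩ := body_spec _ _ h
        refine ⟨fun z hz => by rw [j₄ z hz, i₁ z hz], by omega, ?_⟩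
        rw [j₃, j₂, i₃]
        simp only [i₁ _ (hx _)]
    obtain ⟨i₁, i₂, i₃⟩ := inv
    rw [hz, Nat.zero_add] at i₂
    refine ⟨?_, fun z hz hzy => ?_⟩
    · rw [Function.update_of_ne (by omega), Function.update_self, i₃, i₂]
      simp [List.Vector.ofFn]
    · rw [Function.update_of_ne (by omega), Function.update_of_ne hzy, i₁ z hz]
  · simp only [run_mul, hc₁, run_clear, run_star, run_zero, hc₃]
    have loop : ∀ k (m : ℕ → ℕ), m b = k → ∃ m', ReflTransGen (Run body) m m' ∧ m' b = 0 := by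
      intro k
      induction k with
      | zero => exact fun m hm => ⟨m, .refl, hm⟩
      | succ k ih =>
        intro m hm
        obtain ⟨m₁, h₁⟩ := body_total m (by omega)
        obtain ⟨m', h', h0⟩ := ih m₁ (by have := (body_spec _ _ h₁).1; omega)
        exact ⟨m', .head h₁ h', h0⟩
    obtain ⟨m₂, h₂⟩ := (hF (Function.update (Function.update (Function.update s b (s (xs 0)))
      (b + 4) 0) (b + 1) 0)).2 trivial
    obtain ⟨m₃, h₃, hz⟩ := loop _ m₂ rfl
    exact ⟨_, _, rfl, _, rfl, m₂, h₂, m₃, h₃, _, ⟨hz, rfl⟩, rfl⟩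

theorem Implementable.rfind {n : ℕ} {f : List.Vector ℕ (n + 1) → ℕ}
    (hf : Implementable fun v => Part.some (f v)) :
    Implementable fun v => Nat.rfind fun k => Part.some (f (k ::ᵥ v) = 0) := by
  intro xs y b hx hy hxy
  obtain ⟨F, hF⟩ := hf (Fin.cons b xs) (b + 1) (b + 3)
    (Fin.cases (by simp) fun i => by have := hx i; simp only [Fin.cons_succ]; omega) (by omega)
    (Fin.cases (by simp) fun i => by have := hx i; simp only [Fin.cons_succ]; omega)
  have hc := fun s s' => run_copy (x := b) (y := y) (t := b + 2) (by omega) (by omega) (by omega)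
    (s := s) (s' := s')
  have F_spec : ∀ m m', Run F m m' → m' (b + 1) = f (m b ::ᵥ List.Vector.ofFn fun i => m (xs i)) ∧
      ∀ z ≤ b, m' z = m z := by
    intro m m' h
    obtain ⟨e, e'⟩ := (hF m).1 m' h
    exact ⟨by simpa [List.Vector.ofFn] using e, fun z hz => e' z (by omega) (by omega)⟩
  have F_total : ∀ m, ∃ m', Run F m m' := fun m => (hF m).2 trivial
  -- Counter `b` holds the candidate and `b + 1` the value there. The decrement of `b + 1` lets a
  -- round pass only if this value is nonzero; the test after the loop requires it to be zero. Hence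
  -- a run that ends has found the least root.
  set body : Program := F * (dec (b + 1) * inc b) with hbody
  have body_spec : ∀ m m', Run body m m' → m' b = m b + 1 ∧ (∀ z < b, m' z = m z) ∧
      f (m b ::ᵥ List.Vector.ofFn fun i => m (xs i)) ≠ 0 := by
    intro m m' h
    simp only [hbody, run_mul, run_dec, run_inc] at h
    obtain ⟨m₁, h₁, _, ⟨h₂, rfl⟩, rfl⟩ := h
    obtain ⟨e, e'⟩ := F_spec _ _ h₁
    refine ⟨by simp [e'], fun z hz => ?_, e ▸ h₂⟩
    rw [Function.update_of_ne (by omega), Function.update_of_ne (by omega), e' z (by omega)]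
  have body_total : ∀ m : ℕ → ℕ, f (m b ::ᵥ List.Vector.ofFn fun i => m (xs i)) ≠ 0 →
      ∃ m', Run body m m' := by
    intro m hm
    obtain ⟨m₁, h₁⟩ := F_total m
    exact ⟨_, run_mul.2 ⟨m₁, h₁, run_mul.2 ⟨_, run_dec.2 ⟨by rwa [(F_spec _ _ h₁).1], rfl⟩,
      run_inc.2 rfl⟩⟩⟩
  refine ⟨clear b * (body.star * (F * (zero (b + 1) * copy b y (b + 2)))),
    fun s => ⟨fun s' h => ?_, fun h => ?_⟩⟩
  · simp only [run_mul, run_clear, run_star, run_zero, hc] at h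
    obtain ⟨m₁, h₁, m₂, h₂, m₃, h₃, _, ⟨hz, rfl⟩, rfl⟩ := h
    have inv : (∀ z < b, m₂ z = s z) ∧
        ∀ j < m₂ b, f (j ::ᵥ List.Vector.ofFn fun i => s (xs i)) ≠ 0 := by
      clear hz h₃
      induction h₂ with
      | refl =>
        subst h₁
        exact ⟨fun z hz => by rw [Function.update_of_ne hz.ne], by simp⟩
      | tail _ h ih =>
        obtain ⟨i₁, i₂⟩ := ih
        obtain ⟨j₁, j₂, j₃⟩ := body_spec _ _ h
        refine ⟨fun z hz => by rw [j₂ z hz, i₁ z hz], fun j hj => ?_⟩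
        rcases Nat.lt_succ_iff_lt_or_eq.1 (j₁ ▸ hj) with hj | rfl
        · exact i₂ j hj
        · simpa only [i₁ _ (hx _)] using j₃
    obtain ⟨i₁, i₂⟩ := inv
    obtain ⟨e, e'⟩ := F_spec _ _ h₃
    simp only [i₁ _ (hx _), hz] at e
    refine ⟨?_, fun z hz hzy => ?_⟩
    · rw [Function.update_of_ne (by omega), Function.update_self, e' b le_rfl]
      exact Nat.mem_rfind.2 ⟨by simp [e.symm], fun hj => by simpa using i₂ _ hj⟩
    · rw [Function.update_of_ne (by omega), Function.update_of_ne hzy, e' z hz.le, i₁ z hz]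
  · simp only [run_mul, run_clear, run_star, run_zero, hc]
    obtain ⟨k, hk⟩ := Part.dom_iff_mem.1 h
    obtain ⟨hk₀, hk₁⟩ := Nat.mem_rfind.1 hk
    have loop : ∀ d (m : ℕ → ℕ), (∀ z < b, m z = s z) → m b + d = k →
        ∃ m', ReflTransGen (Run body) m m' ∧ m' b = k ∧ ∀ z < b, m' z = s z := by
      intro d
      induction d with
      | zero => exact fun m hm hd => ⟨m, .refl, hd, hm⟩
      | succ d ih =>
        intro m hm hd
        obtain ⟨m₁, h₁⟩ := body_total m (by
          simp only [hm _ (hx _)]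
          simpa using hk₁ (show m b < k by omega))
        obtain ⟨j₁, j₂, -⟩ := body_spec _ _ h₁
        obtain ⟨m', h', h''⟩ := ih m₁ (fun z hz => by rw [j₂ z hz, hm z hz]) (by omega)
        exact ⟨m', .head h₁ h', h''⟩
    obtain ⟨m₂, h₂, hb, hs⟩ := loop k (Function.update s b 0)
      (fun z hz => by rw [Function.update_of_ne hz.ne]) (by simp)
    obtain ⟨m₃, h₃⟩ := F_total m₂
    refine ⟨_, _, rfl, m₂, h₂, m₃, h₃, _, ⟨?_, rfl⟩, rfl⟩
    rw [(F_spec _ _ h₃).1, hb]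
    simp only [hs _ (hx _)]
    simpa using hk₀

theorem implementable_of_primrec' {n : ℕ} {f : List.Vector ℕ n → ℕ} (hf : Nat.Primrec' f) :
    Implementable fun v => Part.some (f v) := by
  induction hf with
  | zero => exact implementable_zero
  | succ => exact implementable_succ
  | get i => exact implementable_get i
  | comp g _ _ ihf ihg =>
    have := ihf.comp ihg
    simpa only [Vector.mOfFn_part_some, Part.bind_eq_bind, Part.bind_some] using this
  | prec _ _ ihf ihg => exact ihf.prec ihg

theorem implementable_of_partrec' {n : ℕ} {f : List.Vector ℕ n →. ℕ} (hf : Nat.Partrec' f) :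
    Implementable f := by
  induction hf with
  | prim h => exact implementable_of_primrec' h
  | comp g _ _ ihf ihg => exact ihf.comp ihg
  | rfind _ ih => exact ih.rfind

/-- The domain of a partial recursive function is decided by the executions of some program that
starts with the argument in counter `0` and with all other counters empty. -/
theorem exists_program_of_partrec {f : ℕ →. ℕ} (hf : Partrec f) :
    ∃ P : Program, ∀ n, (f n).Dom ↔
      ∃ w ∈ P.matches', run (fun _ => 0) (List.replicate n (0, Op.inc) ++ w) ≠ none := by
  -- The argument is in counter `0`, the result in counter `1`, and scratch space starts at `2`.
  obtain ⟨P, hP⟩ := implementable_of_partrec' (Nat.Partrec'.part_iff₁.2 hf) (fun _ => 0) 1 2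
    (by simp) (by simp) (by simp)
  have hrep : ∀ n (s : ℕ → ℕ), run s (List.replicate n (0, Op.inc)) =
      some (Function.update s 0 (s 0 + n)) := by
    intro n
    induction n with
    | zero => simp [run]
    | succ n ih =>
      intro s
      simp [List.replicate_succ, run, step, ih, add_assoc, add_comm 1]
  refine ⟨P, fun n => ?_⟩
  have h := hP (Function.update (fun _ => 0) 0 n)
  simp only [List.Vector.ofFn, List.Vector.head_cons, Function.update_self] at h
  simp only [run_append, hrep, Option.bind_some, Nat.zero_add, Option.ne_none_iff_exists']
  constructor
  · intro hd
    obtain ⟨s', w, hw, hr⟩ := h.2 hd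
    exact ⟨w, hw, s', hr⟩
  · rintro ⟨w, hw, s', hr⟩
    exact Part.dom_iff_mem.2 ⟨_, (h.1 s' ⟨w, hw, hr⟩).1⟩

end CounterProgram

/-! ### Regular expressions match regular languages -/

namespace Language

variable {α : Type}

/-- By Myhill–Nerode it suffices that there are finitely many left quotients, and closure under
quotients by single letters puts them all in the finite family. -/
theorem isRegular_of_leftQuotient_closed {L : Language α} (F : Set (Language α)) (hF : F.Finite)
    (hL : L ∈ F) (h : ∀ A ∈ F, ∀ a, A.leftQuotient [a] ∈ F) : L.IsRegular := by
  refine .of_finite_range_leftQuotient (hF.subset ?_)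
  rintro _ ⟨w, rfl⟩
  induction w using List.reverseRecOn with
  | nil => exact hL
  | append_singleton w a ih =>
    rw [leftQuotient_append]
    exact h _ ih a

theorem cons_mem_mul {A B : Language α} {a : α} {w : List α} :
    a :: w ∈ A * B ↔ w ∈ A.leftQuotient [a] * B ∨ [] ∈ A ∧ a :: w ∈ B := by
  simp only [mem_mul, mem_leftQuotient]
  constructor
  · rintro ⟨_ | ⟨b, u⟩, hu, v, hv, h⟩
    · exact .inr ⟨hu, by simpa using h ▸ hv⟩
    · obtain ⟨rfl, rfl⟩ := List.cons.inj h
      exact .inl ⟨u, hu, v, hv, rfl⟩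
  · rintro (⟨u, hu, v, hv, rfl⟩ | ⟨h₁, h₂⟩)
    · exact ⟨_, hu, v, hv, rfl⟩
    · exact ⟨_, h₁, _, h₂, rfl⟩

theorem cons_mem_kstar {A : Language α} {a : α} {w : List α} :
    a :: w ∈ KStar.kstar A ↔ w ∈ A.leftQuotient [a] * KStar.kstar A := by
  constructor
  · intro h
    obtain ⟨l, hl, hA⟩ := mem_kstar_iff_exists_nonempty.1 h
    obtain _ | ⟨_ | ⟨b, u⟩, l⟩ := l
    · simp at hl
    · exact absurd rfl (hA [] (by simp)).2
    · obtain ⟨rfl, rfl⟩ := List.cons.inj hl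
      exact mem_mul.2 ⟨u, (hA (a :: u) (by simp)).1, _,
        mem_kstar.2 ⟨l, rfl, fun y hy => (hA y (by simp [hy])).1⟩, rfl⟩
  · intro h
    obtain ⟨u, hu, v, hv, rfl⟩ := mem_mul.1 h
    obtain ⟨l, rfl, hl⟩ := mem_kstar.1 hv
    exact mem_kstar.2 ⟨(a :: u) :: l, rfl, by
      simpa using ⟨hu, hl⟩⟩

/-- The union of a set of languages. -/
def unionOf (S : Set (Language α)) : Language α :=
  {w | ∃ C ∈ S, w ∈ C}

theorem mem_unionOf {S : Set (Language α)} {w : List α} : w ∈ unionOf S ↔ ∃ C ∈ S, w ∈ C :=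
  Iff.rfl

theorem isRegular_singleton (w : List α) : IsRegular ({w} : Language α) := by
  refine isRegular_of_leftQuotient_closed
    (insert (∅ : Set (List α)) ((fun v => ({v} : Set (List α))) '' {v | v ∈ w.tails}))
    ((List.finite_toSet _).image _ |>.insert _) (.inr ⟨w, by simp, rfl⟩) ?_
  rintro _ (rfl | ⟨v, hv, rfl⟩) a
  · exact .inl rfl
  · obtain _ | ⟨b, v⟩ := v
    · left
      ext u
      change [a] ++ u = [] ↔ False
      simp
    · by_cases hab : a = b
      · refine .inr ⟨v, ?_, ?_⟩
        · simp only [Set.mem_ofPred_eq, List.mem_tails] at hv ⊢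
          exact (List.suffix_cons b v).trans hv
        · ext u
          change u = v ↔ [a] ++ u = b :: v
          simp [hab]
      · left
        ext u
        change [a] ++ u = b :: v ↔ False
        simp [hab]

/-- Each left quotient of `A * B` is `C * B` together with a union of left quotients of `B`, where
`C` is a left quotient of `A`; the quotients of `B` come from the splittings where the word of `A`
has already ended. -/
theorem IsRegular.mul {A B : Language α} (hA : A.IsRegular) (hB : B.IsRegular) :
    (A * B).IsRegular := by
  have hA := hA.finite_range_leftQuotient
  have hB := hB.finite_range_leftQuotient
  refine isRegular_of_leftQuotient_closed
    (Set.image2 (fun (C : Language α) (S : Set (Language α)) => C * B + unionOf S)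
      (Set.range A.leftQuotient) (𝒫 Set.range B.leftQuotient))
    (hA.image2 _ hB.powerset) ⟨A, ⟨[], rfl⟩, ∅, by simp, ?_⟩ ?_
  · ext w
    simp [mem_add, mem_unionOf]
  · rintro _ ⟨_, ⟨u, rfl⟩, S, hS, rfl⟩ a
    refine ⟨_, ⟨u ++ [a], rfl⟩, {D | (∃ C ∈ S, D = leftQuotient C [a]) ∨
      [] ∈ A.leftQuotient u ∧ D = B.leftQuotient [a]}, ?_, ?_⟩
    · rintro _ (⟨C, hC, rfl⟩ | ⟨-, rfl⟩)
      · obtain ⟨v, rfl⟩ := hS hC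
        exact ⟨v ++ [a], leftQuotient_append _ _ _⟩
      · exact ⟨[a], rfl⟩
    · ext w
      change w ∈ A.leftQuotient (u ++ [a]) * B + unionOf _ ↔
        a :: w ∈ A.leftQuotient u * B + unionOf S
      rw [mem_add, mem_add, cons_mem_mul,
        leftQuotient_append, or_assoc]
      refine or_congr_right ?_
      constructor
      · rintro ⟨_, ⟨C, hC, rfl⟩ | ⟨h, rfl⟩, hw⟩
        · exact .inr ⟨C, hC, hw⟩
        · exact .inl ⟨h, hw⟩
      · rintro (⟨h, hw⟩ | ⟨C, hC, hw⟩)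
        · exact ⟨_, .inr ⟨h, rfl⟩, hw⟩
        · exact ⟨_, .inl ⟨C, hC, rfl⟩, hw⟩

/-- Apart from the star itself, each left quotient is a union of left quotients of `A` followed by
the star: the union collects the possible unfinished factors. -/
theorem IsRegular.kstar {A : Language α} (hA : A.IsRegular) : (KStar.kstar A).IsRegular := by
  have hA := hA.finite_range_leftQuotient
  refine isRegular_of_leftQuotient_closed
    (insert (KStar.kstar A) ((fun S : Set (Language α) =>
      unionOf S * KStar.kstar A) '' (𝒫 Set.range A.leftQuotient)))
    ((hA.powerset.image _).insert _) (.inl rfl) ?_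
  rintro _ (rfl | ⟨S, hS, rfl⟩) a
  · refine .inr ⟨{A.leftQuotient [a]}, by simp, ?_⟩
    ext w
    rw [mem_leftQuotient, List.singleton_append, cons_mem_kstar]
    simp [mem_mul, mem_unionOf]
  · refine .inr ⟨{D | (∃ C ∈ S, D = leftQuotient C [a]) ∨
      (∃ C ∈ S, [] ∈ C) ∧ D = A.leftQuotient [a]}, ?_, ?_⟩
    · rintro _ (⟨C, hC, rfl⟩ | ⟨-, rfl⟩)
      · obtain ⟨v, rfl⟩ := hS hC
        exact ⟨v ++ [a], leftQuotient_append _ _ _⟩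
      · exact ⟨[a], rfl⟩
    · ext w
      rw [mem_leftQuotient, List.singleton_append, cons_mem_mul, cons_mem_kstar, mem_mul, mem_mul,
        mem_mul]
      constructor
      · rintro ⟨u, ⟨_, ⟨C, hC, rfl⟩ | ⟨h, rfl⟩, hu⟩, v, hv, rfl⟩
        · exact .inl ⟨u, ⟨C, hC, hu⟩, v, hv, rfl⟩
        · exact .inr ⟨h, u, hu, v, hv, rfl⟩
      · rintro (⟨u, ⟨C, hC, hu⟩, v, hv, rfl⟩ | ⟨h, u, hu, v, hv, rfl⟩)
        · exact ⟨u, ⟨_, .inl ⟨C, hC, rfl⟩, hu⟩, v, hv, rfl⟩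
        · exact ⟨u, ⟨_, .inr ⟨h, rfl⟩, hu⟩, v, hv, rfl⟩

end Language

theorem RegularExpression.isRegular_matches' {α : Type} (P : RegularExpression α) :
    P.matches'.IsRegular := by
  induction P with
  | zero =>
    refine Language.isRegular_of_leftQuotient_closed {(∅ : Set (List α))} (Set.finite_singleton _)
      rfl ?_
    rintro _ rfl a
    rfl
  | epsilon => exact Language.isRegular_singleton []
  | char a => exact Language.isRegular_singleton [a]
  | plus P Q hP hQ => exact hP.add hQ
  | comp P Q hP hQ => exact hP.mul hQ
  | star P hP => exact hP.kstar

/-! ### Boundedness of the counters of a program -/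

namespace CounterProgram

/-- This makes the alphabet of instructions finite, as a grammar requires. -/
theorem exists_bound (P : Program) : ∃ K, ∀ w ∈ P.matches', ∀ a ∈ w, a.1 < K := by
  induction P with
  | zero => exact ⟨0, fun w hw => absurd hw (Language.notMem_zero w)⟩
  | epsilon =>
    refine ⟨0, fun w hw => ?_⟩
    obtain rfl := (Language.mem_one w).1 hw
    simp
  | char a =>
    refine ⟨a.1 + 1, ?_⟩
    rintro w rfl
    simp
  | plus P Q hP hQ =>
    obtain ⟨K, hP⟩ := hP
    obtain ⟨K', hQ⟩ := hQ
    refine ⟨max K K', ?_⟩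
    rintro w (hw | hw) a ha
    · exact lt_max_of_lt_left (hP w hw a ha)
    · exact lt_max_of_lt_right (hQ w hw a ha)
  | comp P Q hP hQ =>
    obtain ⟨K, hP⟩ := hP
    obtain ⟨K', hQ⟩ := hQ
    refine ⟨max K K', fun w hw a ha => ?_⟩
    obtain ⟨u, hu, v, hv, rfl⟩ := Language.mem_mul.1 hw
    rcases List.mem_append.1 ha with ha | ha
    · exact lt_max_of_lt_left (hP u hu a ha)
    · exact lt_max_of_lt_right (hQ v hv a ha)
  | star P hP =>
    obtain ⟨K, hP⟩ := hP
    refine ⟨K, fun w hw a ha => ?_⟩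
    obtain ⟨l, rfl, hl⟩ := Language.mem_kstar.1 hw
    obtain ⟨u, hu, ha⟩ := List.mem_flatten.1 ha
    exact hP u (hl u hu) a ha

end CounterProgram

/-! ### Ranks of grammars without padding symbols -/

namespace HyperCFG.CFHG

variable {A X N : Type}

theorem rightEdge_mem_vertices {G : CFHG A X N} {u w : Sentence A X N} (h : G.RightEdge u w) :
    w ∈ G.vertices := by
  rcases h with ⟨r, hr, -, rfl⟩ | ⟨r, -, v, γ, -, -, rfl⟩
  · exact .inr ⟨r, hr, rfl⟩
  · exact .inl ⟨v, rfl⟩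

/-- A grammar whose letters never contain the padding symbol is ranked, if the right sides of its
rules are nonempty and every grammar variable has a right side that starts with a letter. -/
theorem isRanked_of_letterRank_eq_empty {G : CFHG A X N}
    (hrank : ∀ r ∈ G.rules, ∀ σ, Symbol.terminal σ ∈ r.output → letterRank σ = ∅)
    (hletter : ∀ v, ∃ σ γ, (⟨v, Symbol.terminal σ :: γ⟩ : ContextFreeRule (X → Option A) N) ∈
      G.rules) : G.IsRanked := by
  -- The expected solution of the rank equations: as no letter contains the padding symbol, both
  -- ranks are empty wherever a variable stands at the relevant end.
  let L : Sentence A X N → Set X := fun u => match u with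
    | [] => Set.univ
    | Symbol.terminal σ :: _ => letterRank σ
    | Symbol.nonterminal _ :: _ => ∅
  let R : Sentence A X N → Set X := fun u => match u.getLast? with
    | some (Symbol.terminal σ) => letterRank σ
    | _ => ∅
  have hR : ∀ u ∈ G.vertices, R u = ∅ := by
    rintro u (⟨v, rfl⟩ | ⟨r, hr, rfl⟩)
    · rfl
    · simp only [R]
      split
      · next σ h => exact hrank r hr σ (List.mem_of_getLast? h)
      · rfl
  refine ⟨L, R, ⟨rfl, fun _ _ => rfl, fun v γ hv => ?_⟩, ⟨rfl, fun _ _ => by simp [R],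
    fun v γ hv => ?_⟩, fun r hr => ?_⟩
  · symm
    rw [Set.eq_empty_iff_forall_notMem]
    intro x hx
    rw [Set.mem_iInter₂] at hx
    -- It is enough to find one component with an empty left rank in the intersection. If `[v]` lies
    -- in the component at hand, a right side of `v` that starts with a letter provides it;
    -- otherwise the component of `[v]` directly follows and does so.
    by_cases hc : [Symbol.nonterminal v] ∈ component G.LeftEdge (Symbol.nonterminal v :: γ)
    · have hx := hx _ hc
      obtain ⟨σ, δ, hr⟩ := hletter v
      have hσ := hrank _ hr σ (by simp)
      set u : Sentence A X N := Symbol.terminal σ :: δ with hu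
      -- A right side that starts with a letter has no outgoing left edges, so it is a component of
      -- its own.
      have hfix : ∀ w, Relation.ReflTransGen G.LeftEdge u w → w = u := by
        intro w hw
        induction hw with
        | refl => rfl
        | tail _ h ih =>
          subst ih
          rcases h with ⟨r, -, h, -⟩ | ⟨r, -, v', γ', h, h', -⟩
          · simp [hu] at h
          · rw [← h', hu] at h
            simp at h
      have hedge : G.LeftEdge [Symbol.nonterminal v] u := .inl ⟨_, hr, rfl, rfl⟩
      have hx := Set.mem_iInter₂.1 hx (component G.LeftEdge u)
        ⟨⟨u, .inr ⟨_, hr, rfl⟩, rfl⟩, fun h => ?_, _, ⟨.refl, .refl⟩, u, ⟨.refl, .refl⟩, hedge⟩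
      · have hx := Set.mem_iInter₂.1 hx u ⟨.refl, .refl⟩
        simp [L, hu, hσ] at hx
      · have hu' : u ∈ component G.LeftEdge [Symbol.nonterminal v] := by
          rw [h]; exact ⟨.refl, .refl⟩
        have := hfix _ hu'.2
        simp [hu] at this
    · have hx := hx _ ⟨.refl, .refl⟩
      have hedge : G.LeftEdge (Symbol.nonterminal v :: γ) [Symbol.nonterminal v] := by
        rcases hv with ⟨v', h⟩ | ⟨r, hr, h⟩
        · obtain ⟨h, rfl⟩ := List.cons.inj h
          exact absurd ⟨.refl, .refl⟩ hc
        · exact .inr ⟨r, hr, v, γ, h.symm, h, rfl⟩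
      have hx := Set.mem_iInter₂.1 hx (component G.LeftEdge [Symbol.nonterminal v])
        ⟨⟨_, .inl ⟨v, rfl⟩, rfl⟩, fun h => hc (h ▸ ⟨.refl, .refl⟩), _, ⟨.refl, .refl⟩, _,
          ⟨.refl, .refl⟩, hedge⟩
      exact Set.mem_iInter₂.1 hx [Symbol.nonterminal v] ⟨.refl, .refl⟩
  · have h0 : R (γ ++ [Symbol.nonterminal v]) = ∅ := by simp [R]
    rw [h0]
    symm
    simp only [Set.iUnion_eq_empty, auxRight]
    rintro - - _ ⟨⟨d, hd, rfl⟩, -⟩ w hw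
    refine hR w ?_
    have := hw.1
    induction this with
    | refl => exact hd
    | tail _ h _ => exact rightEdge_mem_vertices h
  · have : ∀ a ∈ r.output, R [a] = ∅ := by
      rintro (σ | v) ha
      · exact hrank r hr σ ha
      · rfl
    rw [List.isChain_iff_getElem]
    intro i hi
    rw [this _ (List.getElem_mem _)]
    exact Set.empty_subset _

end HyperCFG.CFHG

/-! ### A context-free grammar for the sequences that cannot be executed -/

namespace CounterProgram

/-- The total change of the counter `x` by an instruction. -/
def weight (x : ℕ) : Instr → ℤ
  | (y, Op.inc) => if y = x then 1 else 0
  | (y, Op.dec) => if y = x then -1 else 0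
  | (_, Op.zero) => 0

theorem step_weight {s s' : ℕ → ℕ} {a : Instr} (h : step s a = some s') (x : ℕ) :
    (s' x : ℤ) = s x + weight x a := by
  obtain ⟨y, _ | _ | _⟩ := a
  · simp only [step, Option.some.injEq] at h
    subst h
    by_cases hy : y = x
    · subst hy; simp [weight]
    · simp [weight, hy, Function.update_of_ne (Ne.symm hy)]
  · simp only [step] at h
    split_ifs at h with h0
    simp only [Option.some.injEq] at h
    subst h
    by_cases hy : y = x
    · subst hy; simp [weight]; omega
    · simp [weight, hy, Function.update_of_ne (Ne.symm hy)]
  · simp only [step] at h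
    split_ifs at h with h0
    simp only [Option.some.injEq] at h
    subst h
    simp [weight]

theorem run_weight {s s' : ℕ → ℕ} {w : List Instr} (h : run s w = some s') (x : ℕ) :
    (s' x : ℤ) = s x + (w.map (weight x)).sum := by
  induction w generalizing s with
  | nil =>
    obtain rfl := Option.some.inj h
    simp
  | cons a w ih =>
    obtain ⟨m, h₁, h₂⟩ := Option.bind_eq_some_iff.1 h
    rw [ih h₂, step_weight h₁ x, List.map_cons, List.sum_cons, add_assoc]

variable {K : ℕ}

/-- The instructions on the first `K` counters. -/
abbrev BoundedInstr (K : ℕ) : Type := Fin K × Op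

/-- A bounded instruction as an instruction. -/
def toInstr (a : BoundedInstr K) : Instr := (a.1, a.2)

/-- The grammar variables of the grammar for the instruction sequences that cannot be executed:
`start` generates the sequences that cannot be executed when all counters are zero, `test` generates
sequences that fail at a test for zero whatever the counters are, and `balanced x` generates
sequences that do not change the counter `x`. -/
inductive Var (K : ℕ) where
  | start
  | test
  | balanced (x : Fin K)
  deriving DecidableEq

instance : Fintype (Var K) :=
  Fintype.ofSurjective (fun o : Option (Option (Fin K)) => match o with
    | none => Var.start
    | some none => Var.test
    | some (some x) => Var.balanced x) (by
      rintro (_ | _ | x)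
      exacts [⟨none, rfl⟩, ⟨some none, rfl⟩, ⟨some (some x), rfl⟩])

/-- A bounded instruction as a symbol. -/
def letter (a : BoundedInstr K) : Symbol (BoundedInstr K) (Var K) := Symbol.terminal a

/-- A grammar variable as a symbol. -/
def var (v : Var K) : Symbol (BoundedInstr K) (Var K) := Symbol.nonterminal v

open Var in
/-- The rules of the grammar for the instruction sequences that cannot be executed. -/
inductive IsRule : Var K → List (Symbol (BoundedInstr K) (Var K)) → Prop
  | start_dec (x) : IsRule start [letter (x, Op.dec)]
  | start_balanced (x) : IsRule start [var (balanced x), letter (x, Op.dec)]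
  | start_test : IsRule start [var test]
  | start_append (a) : IsRule start [var start, letter a]
  | test_cons (a) : IsRule test [letter a, var test]
  | test_zero (x) : IsRule test [letter (x, Op.inc), letter (x, Op.zero)]
  | test_balanced (x) : IsRule test [letter (x, Op.inc), var (balanced x), letter (x, Op.zero)]
  | balanced_pair (x) : IsRule (balanced x) [letter (x, Op.inc), letter (x, Op.dec)]
  | balanced_nest (x) :
      IsRule (balanced x) [letter (x, Op.inc), var (balanced x), letter (x, Op.dec)]
  | balanced_append (x) : IsRule (balanced x) [var (balanced x), var (balanced x)]
  | balanced_letter (x : Fin K) (a) : weight x (toInstr a) = 0 → IsRule (balanced x) [letter a]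

theorem finite_isRule : {r : ContextFreeRule (BoundedInstr K) (Var K) |
    IsRule r.input r.output}.Finite := by
  have h : Set.Finite {l : List (Symbol (BoundedInstr K) (Var K)) | l.length ≤ 3} := by
    have : Finite (Symbol (BoundedInstr K) (Var K)) := by
      refine Finite.of_surjective (fun o : BoundedInstr K ⊕ Var K => o.elim letter var) ?_
      rintro (a | v)
      exacts [⟨.inl a, rfl⟩, ⟨.inr v, rfl⟩]
    exact List.finite_length_le _ 3
  refine ((Set.finite_univ.prod h).image fun p => (⟨p.1, p.2⟩ :
    ContextFreeRule (BoundedInstr K) (Var K))).subset ?_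
  rintro ⟨v, u⟩ hr
  refine ⟨(v, u), ⟨trivial, ?_⟩, rfl⟩
  cases (hr : IsRule v u) <;> simp

/-- The language of a sequence of symbols, given the languages of the grammar variables. -/
def sentenceLanguage {T V : Type} (I : V → Language T) (u : List (Symbol T V)) : Language T :=
  (u.map fun c => match c with
    | Symbol.terminal t => ({[t]} : Language T)
    | Symbol.nonterminal v => I v).prod

section sentenceLanguage

variable {T V : Type} (I : V → Language T)

theorem sentenceLanguage_nil : sentenceLanguage I [] = 1 := rfl

theorem sentenceLanguage_terminal_cons (t : T) (u : List (Symbol T V)) :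
    sentenceLanguage I (Symbol.terminal t :: u) = {[t]} * sentenceLanguage I u := by
  simp [sentenceLanguage]

theorem sentenceLanguage_nonterminal_cons (v : V) (u : List (Symbol T V)) :
    sentenceLanguage I (Symbol.nonterminal v :: u) = I v * sentenceLanguage I u := by
  simp [sentenceLanguage]

theorem sentenceLanguage_append (u w : List (Symbol T V)) :
    sentenceLanguage I (u ++ w) = sentenceLanguage I u * sentenceLanguage I w := by
  simp [sentenceLanguage]

theorem sentenceLanguage_map_terminal (w : List T) :
    sentenceLanguage I (w.map Symbol.terminal) = {w} := by
  induction w with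
  | nil => rfl
  | cons t w ih =>
    rw [List.map_cons, sentenceLanguage_terminal_cons, ih]
    exact Set.image2_singleton

end sentenceLanguage

/-- Languages closed under the rules contain everything derivable, since each derivation step can
only shrink the language of the sentence. This gives soundness once `varLanguage` is shown to be
closed. -/
theorem sentenceLanguage_le_of_derives {T : Type} {g : ContextFreeGrammar T}
    {I : g.NT → Language T} (hI : ∀ r ∈ g.rules, sentenceLanguage I r.output ≤ I r.input)
    {u w : List (Symbol T g.NT)} (h : g.Derives u w) :
    sentenceLanguage I w ≤ sentenceLanguage I u := by
  induction h with
  | refl => exact le_rfl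
  | tail _ h ih =>
    refine le_trans ?_ ih
    obtain ⟨r, hr, h⟩ := h
    obtain ⟨p, q, rfl, rfl⟩ := h.exists_parts
    simp only [sentenceLanguage_append, sentenceLanguage_nonterminal_cons, sentenceLanguage_nil,
      mul_one]
    gcongr
    exact hI r hr

/-- Rename the letters and the grammar variables in a symbol. -/
def mapSymbol {T T' V V' : Type} (τ : T → T') (ν : V → V') : Symbol T V → Symbol T' V'
  | Symbol.terminal t => Symbol.terminal (τ t)
  | Symbol.nonterminal v => Symbol.nonterminal (ν v)

theorem sentenceLanguage_mapSymbol {T T' V V' : Type} {τ : T → T'} {ν : V → V'}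
    {I : V' → Language T'} {J : V → Language T} (h : ∀ v, I (ν v) = Language.map τ (J v))
    (u : List (Symbol T V)) :
    sentenceLanguage I (u.map (mapSymbol τ ν)) = Language.map τ (sentenceLanguage J u) := by
  induction u with
  | nil => simp [sentenceLanguage_nil]
  | cons c u ih =>
    rcases c with t | v
    · rw [List.map_cons, mapSymbol, sentenceLanguage_terminal_cons, sentenceLanguage_terminal_cons,
        map_mul, ih]
      congr 1
      ext w
      change w = [τ t] ↔ ∃ u, u = [t] ∧ u.map τ = w
      simp [eq_comm]
    · rw [List.map_cons, mapSymbol, sentenceLanguage_nonterminal_cons,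
        sentenceLanguage_nonterminal_cons, map_mul, ih, h]

/-- The words that a grammar derives from the grammar variables, up to renaming. -/
def derivedLanguage {T T' V : Type} (g : ContextFreeGrammar T') (τ : T → T') (ν : V → g.NT)
    (v : V) : Language T :=
  {w | g.Derives [Symbol.nonterminal (ν v)] ((w.map τ).map Symbol.terminal)}

theorem derives_of_mem_sentenceLanguage {T T' V : Type} {g : ContextFreeGrammar T'} (τ : T → T')
    (ν : V → g.NT) {u : List (Symbol T V)} {w : List T}
    (h : w ∈ sentenceLanguage (derivedLanguage g τ ν) u) :
    g.Derives (u.map (mapSymbol τ ν)) ((w.map τ).map Symbol.terminal) := by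
  induction u generalizing w with
  | nil =>
    obtain rfl := (Language.mem_one w).1 h
    exact .refl _
  | cons c u ih =>
    rcases c with t | v
    · rw [sentenceLanguage_terminal_cons, Language.mem_mul] at h
      obtain ⟨_, rfl, w, hw, rfl⟩ := h
      exact (ih hw).append_left [Symbol.terminal (τ t)]
    · rw [sentenceLanguage_nonterminal_cons, Language.mem_mul] at h
      obtain ⟨p, hp, w, hw, rfl⟩ := h
      rw [List.map_append, List.map_append]
      exact (ContextFreeGrammar.Derives.append_right hp (u.map (mapSymbol τ ν))).trans
        ((ih hw).append_left _)

/-- The languages that the grammar variables generate. -/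
def varLanguage : Var K → Language (BoundedInstr K)
  | Var.start => {w | run (fun _ => 0) (w.map toInstr) = none}
  | Var.test => {w | ∀ s, run s (w.map toInstr) = none}
  | Var.balanced x => {w | ((w.map toInstr).map (weight x)).sum = 0}

theorem mem_sentenceLanguage_letter {I : Var K → Language (BoundedInstr K)} {a : BoundedInstr K}
    {u : List (Symbol (BoundedInstr K) (Var K))} {w : List (BoundedInstr K)} :
    w ∈ sentenceLanguage I (letter a :: u) ↔ ∃ q ∈ sentenceLanguage I u, w = a :: q := by
  rw [letter, sentenceLanguage_terminal_cons, Language.mem_mul]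
  constructor
  · rintro ⟨_, rfl, q, hq, rfl⟩
    exact ⟨q, hq, rfl⟩
  · rintro ⟨q, hq, rfl⟩
    exact ⟨_, rfl, q, hq, rfl⟩

theorem mem_sentenceLanguage_var {I : Var K → Language (BoundedInstr K)} {v : Var K}
    {u : List (Symbol (BoundedInstr K) (Var K))} {w : List (BoundedInstr K)} :
    w ∈ sentenceLanguage I (var v :: u) ↔
      ∃ p ∈ I v, ∃ q ∈ sentenceLanguage I u, w = p ++ q := by
  rw [var, sentenceLanguage_nonterminal_cons, Language.mem_mul]
  simp only [eq_comm]

theorem mem_sentenceLanguage_nil {I : Var K → Language (BoundedInstr K)}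
    {w : List (BoundedInstr K)} : w ∈ sentenceLanguage I [] ↔ w = [] := by
  rw [sentenceLanguage_nil, Language.mem_one]

/-- The languages in `varLanguage` only have to be closed under the rules. For `balanced x` total
weight zero is enough: if a run survives such a word, counter `x` has its old value, whatever
happened in between. -/
theorem sentenceLanguage_varLanguage_le {v : Var K} {u : List (Symbol (BoundedInstr K) (Var K))}
    (h : IsRule v u) : sentenceLanguage varLanguage u ≤ varLanguage v := by
  intro w (hw : w ∈ sentenceLanguage varLanguage u)
  change w ∈ varLanguage v
  cases h <;> simp only [mem_sentenceLanguage_letter, mem_sentenceLanguage_var,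
    mem_sentenceLanguage_nil] at hw
  case start_dec x =>
    obtain ⟨_, rfl, rfl⟩ := hw
    rfl
  case start_balanced x =>
    obtain ⟨p, hp, _, ⟨_, rfl, rfl⟩, rfl⟩ := hw
    change run _ _ = none
    rw [List.map_append, run_append]
    cases h : run (fun _ => 0) (p.map toInstr) with
    | none => rfl
    | some s =>
      have := run_weight h x
      rw [show (List.map (weight x) (p.map toInstr)).sum = 0 from hp] at this
      simp only [Nat.cast_zero, add_zero, Nat.cast_eq_zero] at this
      simp [run, step, toInstr, this]
  case start_test =>
    obtain ⟨p, hp, _, rfl, rfl⟩ := hw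
    rw [List.append_nil]
    exact hp _
  case start_append a =>
    obtain ⟨p, hp, _, ⟨_, rfl, rfl⟩, rfl⟩ := hw
    change run _ _ = none
    rw [List.map_append, run_append, show run _ (p.map toInstr) = none from hp]
    rfl
  case test_cons a =>
    obtain ⟨_, ⟨p, hp, _, rfl, rfl⟩, rfl⟩ := hw
    intro s
    rw [List.append_nil, List.map_cons, run, Option.bind_eq_none_iff]
    exact fun m _ => hp m
  case test_zero x =>
    obtain ⟨_, ⟨_, rfl, rfl⟩, rfl⟩ := hw
    intro s
    simp [run, step, toInstr]
  case test_balanced x =>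
    obtain ⟨_, ⟨p, hp, _, ⟨_, rfl, rfl⟩, rfl⟩, rfl⟩ := hw
    intro s
    rw [List.map_cons, List.map_append, run, Option.bind_eq_none_iff]
    intro m hm
    rw [run_append]
    cases h : run m (p.map toInstr) with
    | none => rfl
    | some s' =>
      have h₁ := run_weight h x
      have h₂ := step_weight hm x
      rw [show (List.map (weight x) (p.map toInstr)).sum = 0 from hp] at h₁
      simp only [toInstr, weight, if_true] at h₂
      -- The value after the increment is at least one and the balanced word preserves it.
      have : s' x ≠ 0 := by omega
      simp [run, step, toInstr, this]
  case balanced_pair x =>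
    obtain ⟨_, ⟨_, rfl, rfl⟩, rfl⟩ := hw
    change List.sum _ = 0
    simp [toInstr, weight]
  case balanced_nest x =>
    obtain ⟨_, ⟨p, hp, _, ⟨_, rfl, rfl⟩, rfl⟩, rfl⟩ := hw
    have hp : (List.map (weight x) (p.map toInstr)).sum = 0 := hp
    change List.sum _ = 0
    rw [List.map_cons, List.map_append, List.map_cons, List.map_append, List.sum_cons,
      List.sum_append, hp]
    simp [toInstr, weight]
  case balanced_append x =>
    obtain ⟨p, hp, _, ⟨q, hq, _, rfl, rfl⟩, rfl⟩ := hw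
    have hp : (List.map (weight x) (p.map toInstr)).sum = 0 := hp
    have hq : (List.map (weight x) (q.map toInstr)).sum = 0 := hq
    change List.sum _ = 0
    rw [List.append_nil, List.map_append, List.map_append, List.sum_append, hp, hq, add_zero]
  case balanced_letter x a ha =>
    obtain ⟨_, rfl, rfl⟩ := hw
    change List.sum _ = 0
    simpa using ha

/-! ### Completeness of the grammar -/

section completeness

variable {I : Var K → Language (BoundedInstr K)}

/-- The words that raise the counter `x` by `k`, as words with `k` increments that are not undone
and that are separated by words of `I (balanced x)` or empty words. -/
def Raises (I : Var K → Language (BoundedInstr K)) (x : Fin K) :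
    ℕ → List (BoundedInstr K) → Prop
  | 0, w => w = [] ∨ w ∈ I (Var.balanced x)
  | k + 1, w => ∃ p q, w = p ++ (x, Op.inc) :: q ∧ Raises I x k p ∧
      (q = [] ∨ q ∈ I (Var.balanced x))

variable (hI : ∀ v u, IsRule v u → sentenceLanguage I u ≤ I v)

include hI

/-- The appended word is absorbed into the last balanced block by `balanced_append`; empty blocks
need separate treatment because the grammar has no empty rules. -/
theorem Raises.append {x : Fin K} {k : ℕ} {p q : List (BoundedInstr K)} (hp : Raises I x k p)
    (hq : Raises I x 0 q) : Raises I x k (p ++ q) := by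
  have h0 : ∀ p, Raises I x 0 p → Raises I x 0 (p ++ q) := by
    rintro p (rfl | hp)
    · exact hq
    · obtain rfl | hq := hq
      · exact .inr (by rwa [List.append_nil])
      · exact .inr (hI _ _ (.balanced_append x) (mem_sentenceLanguage_var.2
          ⟨p, hp, q, mem_sentenceLanguage_var.2 ⟨q, hq, [], mem_sentenceLanguage_nil.2 rfl,
            (List.append_nil q).symm⟩, rfl⟩))
  cases k with
  | zero => exact h0 p hp
  | succ k =>
    obtain ⟨p, p', rfl, hp, hp'⟩ := hp
    exact ⟨p, p' ++ q, by simp, hp, h0 p' hp'⟩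

/-- Increments and decrements of `x` match like brackets. An increment opens a new block, a
decrement closes the last open increment `(x, Op.inc) :: q` into a balanced word that joins the
block before it, and any other letter is balanced itself. -/
theorem raises_of_run {w : List (BoundedInstr K)} {s : ℕ → ℕ}
    (h : run (fun _ => 0) (w.map toInstr) = some s) (x : Fin K) : Raises I x (s x) w := by
  induction w using List.reverseRecOn generalizing s with
  | nil =>
    obtain rfl := Option.some.inj h
    exact .inl rfl
  | append_singleton w a ih =>
    rw [List.map_append, run_append, Option.bind_eq_some_iff] at h
    obtain ⟨m, h₁, h₂⟩ := h
    rw [List.map_singleton, run, Option.bind_eq_some_iff] at h₂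
    obtain ⟨s', h₂, hs⟩ := h₂
    obtain rfl := Option.some.inj hs
    have ih := ih h₁
    have hw := step_weight h₂ x
    by_cases ha : weight x (toInstr a) = 0
    · rw [ha, add_zero, Nat.cast_inj] at hw
      rw [hw]
      exact ih.append hI (.inr (hI _ _ (.balanced_letter x a ha)
        (mem_sentenceLanguage_letter.2 ⟨[], mem_sentenceLanguage_nil.2 rfl, rfl⟩)))
    · obtain ⟨y, _ | _ | _⟩ := a
      · by_cases hy : y = x
        · subst hy
          simp only [toInstr, weight, if_true] at hw
          rw [show s' y = m y + 1 by omega]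
          exact ⟨w, [], rfl, ih, .inl rfl⟩
        · exact absurd (by simp [toInstr, weight, Fin.val_inj, hy]) ha
      · by_cases hy : y = x
        · subst hy
          simp only [toInstr, weight, if_true] at hw
          rw [show m y = s' y + 1 by omega] at ih
          obtain ⟨p, q, rfl, hp, hq⟩ := ih
          rw [List.append_assoc]
          refine hp.append hI (.inr ?_)
          obtain rfl | hq := hq
          · exact hI _ _ (.balanced_pair y) (mem_sentenceLanguage_letter.2 ⟨_,
              mem_sentenceLanguage_letter.2 ⟨[], mem_sentenceLanguage_nil.2 rfl, rfl⟩, rfl⟩)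
          · exact hI _ _ (.balanced_nest y) (mem_sentenceLanguage_letter.2 ⟨_,
              mem_sentenceLanguage_var.2 ⟨q, hq, _, mem_sentenceLanguage_letter.2
                ⟨[], mem_sentenceLanguage_nil.2 rfl, rfl⟩, rfl⟩, rfl⟩)
        · exact absurd (by simp [toInstr, weight, Fin.val_inj, hy]) ha
      · exact absurd rfl ha

/-- Consider the first instruction that fails. If it is a decrement, its counter is zero and the
word before it is empty or balanced. If it is a test, its counter is positive, so some increment is
never undone, and the rest after the last such increment is empty or balanced. Rules that add
letters on either side supply the remaining word. -/
theorem mem_start_of_run_eq_none {w : List (BoundedInstr K)}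
    (h : run (fun _ => 0) (w.map toInstr) = none) : w ∈ I Var.start := by
  induction w using List.reverseRecOn with
  | nil => simp [run] at h
  | append_singleton w a ih =>
    cases hw : run (fun _ => 0) (w.map toInstr) with
    | none =>
      exact hI _ _ (.start_append a) (mem_sentenceLanguage_var.2 ⟨w, ih hw, _,
        mem_sentenceLanguage_letter.2 ⟨[], mem_sentenceLanguage_nil.2 rfl, rfl⟩, rfl⟩)
    | some s =>
      rw [List.map_append, run_append, hw, Option.bind_some, List.map_singleton, run,
        Option.bind_eq_none_iff] at h
      have h : step s (toInstr a) = none := by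
        cases hs : step s (toInstr a) with
        | none => rfl
        | some s' => exact absurd (h s' hs) (by simp [run])
      obtain ⟨x, _ | _ | _⟩ := a
      · simp [step, toInstr] at h
      · have hx : s x = 0 := by simpa [step, toInstr] using h
        have hr := raises_of_run hI hw x
        rw [hx] at hr
        obtain rfl | hr := hr
        · exact hI _ _ (.start_dec x) (mem_sentenceLanguage_letter.2
            ⟨[], mem_sentenceLanguage_nil.2 rfl, rfl⟩)
        · exact hI _ _ (.start_balanced x) (mem_sentenceLanguage_var.2 ⟨w, hr, _,
            mem_sentenceLanguage_letter.2 ⟨[], mem_sentenceLanguage_nil.2 rfl, rfl⟩, rfl⟩)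
      · have hx : s x ≠ 0 := by simpa [step, toInstr] using h
        have hr := raises_of_run hI hw x
        obtain ⟨k, hk⟩ := Nat.exists_eq_succ_of_ne_zero hx
        rw [hk] at hr
        obtain ⟨p, q, rfl, -, hq⟩ := hr
        have htest : (x, Op.inc) :: q ++ [(x, Op.zero)] ∈ I Var.test := by
          obtain rfl | hq := hq
          · exact hI _ _ (.test_zero x) (mem_sentenceLanguage_letter.2 ⟨_,
              mem_sentenceLanguage_letter.2 ⟨[], mem_sentenceLanguage_nil.2 rfl, rfl⟩, rfl⟩)
          · exact hI _ _ (.test_balanced x) (mem_sentenceLanguage_letter.2 ⟨_,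
              mem_sentenceLanguage_var.2 ⟨q, hq, _, mem_sentenceLanguage_letter.2
                ⟨[], mem_sentenceLanguage_nil.2 rfl, rfl⟩, rfl⟩, rfl⟩)
        have hprefix : ∀ p : List (BoundedInstr K),
            p ++ ((x, Op.inc) :: q ++ [(x, Op.zero)]) ∈ I Var.test := by
          intro p
          induction p with
          | nil => exact htest
          | cons a p ih =>
            exact hI _ _ (.test_cons a) (mem_sentenceLanguage_letter.2 ⟨_,
              mem_sentenceLanguage_var.2 ⟨_, ih, [], mem_sentenceLanguage_nil.2 rfl,
                (List.append_nil _).symm⟩, rfl⟩)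
        exact hI _ _ .start_test (mem_sentenceLanguage_var.2 ⟨_, hprefix p, [],
          mem_sentenceLanguage_nil.2 rfl, by simp⟩)

end completeness

end CounterProgram

/-! ### The hypergrammar and its hyperlanguage -/

open Classical in
theorem HyperCFG.CFHG.mem_rules_underlying {A X N : Type} {G : CFHG A X N}
    {r : ContextFreeRule (X → Option A) N} : r ∈ G.underlying.rules ↔ r ∈ G.rules :=
  List.mem_toFinset

namespace CounterProgram

variable {K : ℕ}

/-- Soundness takes the images of `varLanguage` as languages closed under the rules; completeness
takes the derived languages themselves. The renamings `τ` and `ν` account for letters and variables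
being coded by numbers. -/
theorem mem_language_iff {T : Type} {g : ContextFreeGrammar T} {τ : BoundedInstr K → T}
    {ν : Var K ≃ g.NT} (hinit : g.initial = ν Var.start)
    (hrules : ∀ r, r ∈ g.rules ↔ ∃ v u, IsRule v u ∧ r = ⟨ν v, u.map (mapSymbol τ ν)⟩)
    {w : List T} : w ∈ g.language ↔
      ∃ u : List (BoundedInstr K), run (fun _ => 0) (u.map toInstr) = none ∧ w = u.map τ := by
  rw [ContextFreeGrammar.mem_language_iff, hinit]
  constructor
  · intro h
    let I : g.NT → Language T := fun v => Language.map τ (varLanguage (ν.symm v))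
    have hIν : ∀ v, I (ν v) = Language.map τ (varLanguage v) := fun v => by simp [I]
    have hI : ∀ r ∈ g.rules, sentenceLanguage I r.output ≤ I r.input := by
      intro r hr
      obtain ⟨v, u, hu, rfl⟩ := (hrules r).1 hr
      rw [sentenceLanguage_mapSymbol hIν, hIν]
      exact Set.image_mono (sentenceLanguage_varLanguage_le hu)
    have h := sentenceLanguage_le_of_derives hI h
    rw [sentenceLanguage_map_terminal, sentenceLanguage_nonterminal_cons, sentenceLanguage_nil,
      mul_one, hIν] at h
    obtain ⟨u, hu, rfl⟩ := h rfl
    exact ⟨u, hu, rfl⟩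
  · rintro ⟨u, hu, rfl⟩
    refine mem_start_of_run_eq_none (I := derivedLanguage g τ ν) (fun v u h w hw => ?_) hu
    have hr := (hrules _).2 ⟨v, u, h, rfl⟩
    exact ContextFreeGrammar.Produces.trans_derives ⟨_, hr,
      ContextFreeRule.Rewrites.input_output⟩ (derives_of_mem_sentenceLanguage τ ν hw)

/-- The letters of the alphabet `Fin n` that stand for bounded instructions. -/
noncomputable abbrev letterEquiv (K : ℕ) :
    BoundedInstr K ≃ Fin (Fintype.card (BoundedInstr K)) := Fintype.equivFin _

/-- The instruction that a letter stands for. -/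
noncomputable def decode (a : Fin (Fintype.card (BoundedInstr K))) : Instr :=
  toInstr ((letterEquiv K).symm a)

/-- A bounded instruction as a letter of a hypergrammar with one word variable. -/
noncomputable def columnLetter (a : BoundedInstr K) :
    Fin 1 → Option (Fin (Fintype.card (BoundedInstr K))) :=
  fun _ => some (letterEquiv K a)

open HyperCFG

/-- The hypergrammar, with one universally quantified word variable, for the instruction sequences
that cannot be executed. -/
noncomputable def failureGrammar (K : ℕ) :
    CFHG (Fin (Fintype.card (BoundedInstr K))) (Fin 1) (Fin (Fintype.card (Var K))) where
  initial := Fintype.equivFin _ Var.start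
  rules := finite_isRule.toFinset.toList.map fun r =>
    ⟨Fintype.equivFin _ r.input, r.output.map (mapSymbol columnLetter (Fintype.equivFin _))⟩
  condition := [(Quantifier.all, 0)]
  condition_nodup := by simp
  condition_complete := by simp [Fin.eq_zero]

theorem mem_rules_failureGrammar {r} : r ∈ (failureGrammar K).rules ↔ ∃ v u, IsRule v u ∧
    r = ⟨Fintype.equivFin _ v, u.map (mapSymbol columnLetter (Fintype.equivFin _))⟩ := by
  simp only [failureGrammar, List.mem_map, Finset.mem_toList, Set.Finite.mem_toFinset,
    Set.mem_ofPred_eq]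
  constructor
  · rintro ⟨⟨v, u⟩, h, rfl⟩
    exact ⟨v, u, h, rfl⟩
  · rintro ⟨v, u, h, rfl⟩
    exact ⟨⟨v, u⟩, h, rfl⟩

theorem mem_rules_underlying {r} : r ∈ (failureGrammar K).underlying.rules ↔ ∃ v u, IsRule v u ∧
    r = ⟨Fintype.equivFin _ v, u.map (mapSymbol columnLetter (Fintype.equivFin _))⟩ :=
  CFHG.mem_rules_underlying.trans mem_rules_failureGrammar

theorem mem_language_underlying {w} : w ∈ (failureGrammar K).underlying.language ↔
    ∃ u : List (BoundedInstr K), run (fun _ => 0) (u.map toInstr) = none ∧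
      w = u.map columnLetter :=
  mem_language_iff (g := (failureGrammar K).underlying) (ν := Fintype.equivFin (Var K)) rfl
    fun _ => mem_rules_underlying

theorem wordAssignment_fin_one {A : Type} (u : Fin 1 → List (Option A)) :
    wordAssignment u = (u 0).map fun a _ => a := by
  rw [wordAssignment]
  apply List.ext_getElem
  · simp
  · intro i h _
    simp only [List.length_map, List.length_range, Finset.univ_unique, Finset.sup_singleton] at h
    simp only [List.getElem_map, List.getElem_range]
    funext x
    obtain rfl := Fin.eq_zero x
    exact List.getD_eq_getElem _ _ h

/-- No letter of the grammar is a padding symbol, so the only padding of `w` that can be derived is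
`w` itself. -/
theorem mem_hyperlanguage_failureGrammar {L : Language (Fin (Fintype.card (BoundedInstr K)))} :
    L ∈ (failureGrammar K).hyperlanguage ↔
      ∀ w ∈ L, run (fun _ => 0) (w.map decode) = none := by
  change (∀ w ∈ L, ∃ w' ∈ paddings w, wordAssignment _ ∈ (failureGrammar K).underlying.language) ↔ _
  refine forall₂_congr fun w _ => ?_
  simp only [wordAssignment_fin_one, Function.update_self, mem_language_underlying]
  constructor
  · rintro ⟨w', hw', u, hu, h⟩
    have h : w' = u.map fun a => some (letterEquiv K a) := by
      have := congrArg (List.map fun σ => σ 0) h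
      simpa [columnLetter, Function.comp_def] using this
    have hw : w = u.map (letterEquiv K) := by
      rw [← show w'.reduceOption = w from hw', h]
      simp [List.reduceOption, List.filterMap_map]
    rw [hw, List.map_map]
    convert hu using 3
    funext a
    simp [decode]
  · intro h
    refine ⟨w.map some, by simp [paddings, List.reduceOption, List.filterMap_map],
      w.map (letterEquiv K).symm, ?_, ?_⟩
    · rw [List.map_map]
      exact h
    · rw [List.map_map, List.map_map]
      congr 1
      funext a i
      simp [columnLetter]

theorem isUniversal_failureGrammar : (failureGrammar K).IsUniversal := by
  simp [CFHG.IsUniversal, failureGrammar]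

theorem derives_of_isRule {v : Var K} {u : List (Symbol (BoundedInstr K) (Var K))}
    (h : IsRule v u) : (failureGrammar K).underlying.Derives
      [Symbol.nonterminal (Fintype.equivFin (Var K) v)]
      (u.map (mapSymbol columnLetter (Fintype.equivFin _))) :=
  .single ⟨_, mem_rules_underlying.2 ⟨v, u, h, rfl⟩, ContextFreeRule.Rewrites.input_output⟩

theorem isReduced_failureGrammar (x : Fin K) : (failureGrammar K).IsReduced where
  productive v := by
    obtain ⟨v, rfl⟩ := (Fintype.equivFin (Var K)).surjective v
    obtain _ | _ | y := v
    · exact ⟨[columnLetter (x, Op.dec)], derives_of_isRule (.start_dec x)⟩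
    · exact ⟨[columnLetter (x, Op.inc), columnLetter (x, Op.zero)],
        derives_of_isRule (.test_zero x)⟩
    · exact ⟨[columnLetter (y, Op.inc), columnLetter (y, Op.dec)],
        derives_of_isRule (.balanced_pair y)⟩
  reachable v := by
    obtain ⟨v, rfl⟩ := (Fintype.equivFin (Var K)).surjective v
    obtain _ | _ | y := v
    · exact ⟨[], [], .refl _⟩
    · exact ⟨[], [], derives_of_isRule .start_test⟩
    · exact ⟨[], [Symbol.terminal (columnLetter (y, Op.dec))],
        derives_of_isRule (.start_balanced y)⟩
  empty_rule r hr h := by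
    obtain ⟨v, u, hu, rfl⟩ := mem_rules_failureGrammar.1 hr
    cases hu <;> simp at h

theorem isRanked_failureGrammar (x : Fin K) : (failureGrammar K).IsRanked := by
  refine CFHG.isRanked_of_letterRank_eq_empty (fun r hr σ hσ => ?_) fun v => ?_
  · obtain ⟨v, u, -, rfl⟩ := mem_rules_failureGrammar.1 hr
    obtain ⟨a | v, -, h⟩ := List.mem_map.1 hσ
    · obtain rfl := Symbol.terminal.inj h
      simp [letterRank, columnLetter]
    · cases h
  · obtain ⟨v, rfl⟩ := (Fintype.equivFin (Var K)).surjective v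
    simp only [mem_rules_failureGrammar]
    obtain _ | _ | y := v
    · exact ⟨_, _, _, _, .start_dec x, rfl⟩
    · exact ⟨_, _, _, _, .test_zero x, rfl⟩
    · exact ⟨_, _, _, _, .balanced_pair y, rfl⟩

end CounterProgram

/-! ### Automata for the prefixed languages -/

theorem Language.IsRegular.exists_fin_dfa {α : Type} {L : Language α} (h : L.IsRegular) :
    ∃ (S : ℕ) (M : DFA α (Fin (S + 1))), M.start = 0 ∧ M.accepts = L := by
  obtain ⟨σ, _, M, rfl⟩ := h
  have : Nonempty σ := ⟨M.start⟩
  obtain ⟨S, hS⟩ := Nat.exists_eq_succ_of_ne_zero (Fintype.card_ne_zero (α := σ))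
  let e := Fintype.equivFinOfCardEq hS
  let e' := e.trans (Equiv.swap (e M.start) 0)
  exact ⟨S, DFA.reindex e' M, by simp [DFA.reindex, e'], DFA.accepts_reindex M e'⟩

namespace HyperCFG

variable {N S : ℕ}

/-- The automaton that reads `n` times the letter `a` and then continues like `M`. -/
noncomputable def prefixAutomaton (a : Fin N) (M : DFA (Fin N) (Fin (S + 1))) (n : ℕ) :
    FiniteNFA (Fin N) (Fin (n + (S + 1))) where
  transitions :=
    (List.finRange n).map (fun i => (⟨i, by omega⟩, a, ⟨i + 1, by omega⟩)) ++
    (Finset.univ : Finset (Fin (S + 1) × Fin N)).toList.map fun p =>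
      (Fin.natAdd n p.1, p.2, Fin.natAdd n (M.step p.1 p.2))
  start := [⟨0, by omega⟩]
  accept := (M.accept.toFinite.toFinset).toList.map (Fin.natAdd n)

theorem prefixAutomaton_step_natAdd (a : Fin N) (M : DFA (Fin N) (Fin (S + 1))) (n : ℕ)
    (q : Fin (S + 1)) (c : Fin N) :
    (prefixAutomaton a M n).toNFA.step (Fin.natAdd n q) c = {Fin.natAdd n (M.step q c)} := by
  ext q'
  simp only [FiniteNFA.toNFA, prefixAutomaton, Set.mem_ofPred_eq, List.mem_append, List.mem_map,
    List.mem_finRange, Finset.mem_toList, Finset.mem_univ, true_and, Prod.mk.injEq,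
    Set.mem_singleton_iff]
  constructor
  · rintro (⟨i, h, -, -⟩ | ⟨⟨p, d⟩, h, rfl, rfl⟩)
    · have := congrArg Fin.val h
      simp only [Fin.val_natAdd] at this
      omega
    · rw [(Fin.natAdd_inj n).1 h]
  · rintro rfl
    exact .inr ⟨(q, c), rfl, rfl, rfl⟩

theorem prefixAutomaton_step_of_lt (a : Fin N) (M : DFA (Fin N) (Fin (S + 1))) {n i : ℕ}
    (hi : i < n) (c : Fin N) :
    (prefixAutomaton a M n).toNFA.step ⟨i, by omega⟩ c =
      {q | c = a ∧ q = ⟨i + 1, by omega⟩} := by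
  ext q'
  simp only [FiniteNFA.toNFA, prefixAutomaton, Set.mem_ofPred_eq, List.mem_append, List.mem_map,
    List.mem_finRange, Finset.mem_toList, Finset.mem_univ, true_and, Prod.mk.injEq]
  constructor
  · rintro (⟨j, h, rfl, rfl⟩ | ⟨⟨p, d⟩, h, -, -⟩)
    · have := congrArg Fin.val h
      simp only at this
      simp [this]
    · have := congrArg Fin.val h
      simp only [Fin.val_natAdd] at this
      omega
  · rintro ⟨rfl, rfl⟩
    exact .inl ⟨⟨i, hi⟩, rfl, rfl, rfl⟩

theorem acceptsFrom_natAdd (a : Fin N) (M : DFA (Fin N) (Fin (S + 1))) (n : ℕ)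
    (q : Fin (S + 1)) :
    (prefixAutomaton a M n).toNFA.acceptsFrom {Fin.natAdd n q} = M.acceptsFrom q := by
  ext w
  induction w generalizing q with
  | nil =>
    rw [NFA.nil_mem_acceptsFrom, DFA.mem_acceptsFrom]
    simp only [Set.mem_singleton_iff, exists_eq_left, FiniteNFA.toNFA, prefixAutomaton,
      Set.mem_ofPred_eq, List.mem_map, Finset.mem_toList, Set.Finite.mem_toFinset,
      DFA.evalFrom_nil, Fin.natAdd_inj, exists_eq_right]
  | cons c w ih =>
    rw [NFA.cons_mem_acceptsFrom, NFA.stepSet_singleton, prefixAutomaton_step_natAdd, ih]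
    rfl

/-- State `i` of the initial chain still has to read `k = n - i` copies of `a`; when `k = 0` it is
the initial state of the shifted copy of `M`, which is why `M.start = 0` is needed. -/
theorem mem_acceptsFrom_of_le (a : Fin N) (M : DFA (Fin N) (Fin (S + 1))) (hM : M.start = 0)
    {n : ℕ} (k i : ℕ) (hi : i + k = n) (w : List (Fin N)) :
    w ∈ (prefixAutomaton a M n).toNFA.acceptsFrom {⟨i, by omega⟩} ↔
      ∃ u ∈ M.accepts, w = List.replicate k a ++ u := by
  induction k generalizing i w with
  | zero =>
    have : (⟨i, by omega⟩ : Fin (n + (S + 1))) = Fin.natAdd n 0 := by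
      ext
      simpa using hi
    rw [this, acceptsFrom_natAdd, DFA.accepts, hM]
    simp
  | succ k ih =>
    cases w with
    | nil =>
      rw [NFA.nil_mem_acceptsFrom]
      simp only [Set.mem_singleton_iff, exists_eq_left, FiniteNFA.toNFA, prefixAutomaton,
        Set.mem_ofPred_eq, List.mem_map]
      constructor
      · rintro ⟨q, -, h⟩
        have := congrArg Fin.val h
        simp only [Fin.val_natAdd] at this
        omega
      · rintro ⟨u, -, h⟩
        simp [List.replicate_succ] at h
    | cons c w =>
      rw [NFA.cons_mem_acceptsFrom, NFA.stepSet_singleton,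
        prefixAutomaton_step_of_lt a M (by omega)]
      by_cases hc : c = a
      · subst hc
        simp only [true_and, Set.ofPred_eq_eq_singleton, ih (i + 1) (by omega),
          List.replicate_succ, List.cons_append, List.cons.injEq]
      · simp only [hc, false_and, List.replicate_succ, List.cons_append, List.cons.injEq, and_false,
          exists_false, iff_false]
        rintro ⟨q, -, hq⟩
        rw [NFA.mem_evalFrom_iff_exists] at hq
        obtain ⟨_, h, -⟩ := hq
        exact h

theorem mem_accepts_prefixAutomaton (a : Fin N) (M : DFA (Fin N) (Fin (S + 1)))
    (hM : M.start = 0) (n : ℕ) (w : List (Fin N)) :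
    w ∈ (prefixAutomaton a M n).toNFA.accepts ↔
      ∃ u ∈ M.accepts, w = List.replicate n a ++ u := by
  rw [← mem_acceptsFrom_of_le a M hM n 0 (Nat.zero_add n) w, NFA.accepts_eq_acceptsFrom_start]
  have : (prefixAutomaton a M n).toNFA.start = {⟨0, by omega⟩} := by
    ext q
    simp [FiniteNFA.toNFA, prefixAutomaton]
  rw [this]

/-- The input of the regular membership problem that consists of a hypergrammar `G` and of the
automaton that reads `n` times the letter `a` and then continues like `M`. -/
noncomputable def prefixInput {k m : ℕ} (G : CFHG (Fin N) (Fin k) (Fin m)) (a : Fin N)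
    (M : DFA (Fin N) (Fin (S + 1))) (n : ℕ) : MembershipInput :=
  ⟨N, k, m, n + (S + 1), G, prefixAutomaton a M n⟩

theorem computable_encode_prefixInput {k m : ℕ} (G : CFHG (Fin N) (Fin k) (Fin m)) (a : Fin N)
    (M : DFA (Fin N) (Fin (S + 1))) :
    Computable fun n => (prefixInput G a M n).encode := by
  let T : List (ℕ × ℕ × ℕ) := (Finset.univ : Finset (Fin (S + 1) × Fin N)).toList.map fun p =>
    (p.1.val, p.2.val, (M.step p.1 p.2).val)
  let F : List ℕ := (M.accept.toFinite.toFinset).toList.map Fin.val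
  -- Only the number of states, the chain and the shift by `n` depend on `n`; the grammar and the
  -- tables `T` and `F` are constants.
  have h : ∀ n, (prefixInput G a M n).encode =
      ((N, k, m, n + (S + 1)),
        (G.initial.val, G.rules.map fun r => (r.input.val, r.output.map encodeSymbol),
          G.condition.map fun q => (encodeQuantifier q.1, q.2.val)),
        ((List.range n).map (fun i => (i, a.val, i + 1)) ++
          T.map (fun t => (n + t.1, t.2.1, n + t.2.2)), [0], F.map fun q => n + q)) := by
    intro n
    simp only [MembershipInput.encode, prefixInput, prefixAutomaton, T, F, List.map_append,
      List.map_map, ← List.map_coe_finRange_eq_range]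
    rfl
  refine Primrec.to_comp (Primrec.of_eq ?_ fun n => (h n).symm)
  have hadd : Primrec₂ fun n q : ℕ => n + q := Primrec.nat_add
  refine .pair (.pair (.const _) (.pair (.const _) (.pair (.const _)
    (hadd.comp .id (.const _))))) (.pair (.const _) (.pair ?_ (.pair (.const _) ?_)))
  · refine Primrec.list_append.comp (Primrec.list_map Primrec.list_range ?_)
      (Primrec.list_map (.const T) ?_)
    · exact Primrec.pair .snd (Primrec.pair (.const _) (Primrec.succ.comp .snd))
    · exact Primrec.pair (hadd.comp .fst (Primrec.fst.comp .snd))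
        (Primrec.pair (Primrec.fst.comp (Primrec.snd.comp .snd))
          (hadd.comp .fst (Primrec.snd.comp (Primrec.snd.comp .snd))))
  · exact Primrec.list_map (.const F) (hadd.comp .fst .snd)

end HyperCFG

/-! ### The reduction from the halting problem -/

open CounterProgram HyperCFG in
/-- Membership instances that a computable function produces decide the domain of a partial
recursive function. -/
theorem exists_inputs_of_partrec {f : ℕ →. ℕ} (hf : Partrec f) (hne : ∃ n, (f n).Dom) :
    ∃ I : ℕ → MembershipInput, (Computable fun n => (I n).encode) ∧ ∀ n,
      ((I n).grammar.IsUniversal ∧ (I n).grammar.IsSync ∧ ∃ w, w ∈ (I n).language) ∧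
      ((I n).language ∈ (I n).grammar.hyperlanguage ↔ ¬ (f n).Dom) := by
  obtain ⟨P, hP⟩ := exists_program_of_partrec hf
  obtain ⟨K, hK⟩ := exists_bound P
  obtain ⟨σ, _, M₀, hM₀⟩ := P.isRegular_matches'
  -- With `K + 1` counters, counter `0` exists even if `K = 0`. It carries the argument and is
  -- needed for the grammar to be productive.
  obtain ⟨S, M, hM, hML⟩ := Language.IsRegular.exists_fin_dfa
    (L := (M₀.comap (decode (K := K + 1))).accepts) ⟨σ, inferInstance, _, rfl⟩
  have hmem : ∀ u, u ∈ M.accepts ↔ u.map decode ∈ P.matches' := by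
    intro u
    rw [hML, DFA.accepts_comap, hM₀]
    rfl
  have hlift : ∀ w ∈ P.matches', ∃ u : List (Fin _), u.map (decode (K := K + 1)) = w := by
    intro w hw
    refine ⟨w.attach.map fun b => letterEquiv (K + 1)
      (⟨b.1.1, (hK w hw b.1 b.2).trans K.lt_succ_self⟩, b.1.2), ?_⟩
    rw [List.map_map]
    conv_rhs => rw [← List.attach_map_subtype_val w]
    congr 1
    funext b
    simp [decode, toInstr]
  let a : Fin (Fintype.card (BoundedInstr (K + 1))) := letterEquiv (K + 1) (0, Op.inc)
  have ha : decode a = (0, Op.inc) := by simp [a, decode, toInstr]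
  refine ⟨prefixInput (failureGrammar (K + 1)) a M, computable_encode_prefixInput _ _ _,
    fun n => ⟨⟨isUniversal_failureGrammar, ⟨isReduced_failureGrammar 0,
      isRanked_failureGrammar 0⟩, ?_⟩, ?_⟩⟩
  -- A defined value of `f` shows that `P` matches some word, so the language is nonempty for every
  -- `n`, even where `f n` is undefined.
  · obtain ⟨n', hn'⟩ := hne
    obtain ⟨w, hw, -⟩ := (hP n').1 hn'
    obtain ⟨u, rfl⟩ := hlift w hw
    exact ⟨_, (mem_accepts_prefixAutomaton a M hM n _).2 ⟨u, (hmem u).2 hw, rfl⟩⟩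
  · refine mem_hyperlanguage_failureGrammar.trans ?_
    rw [hP n]
    push Not
    constructor
    · intro h w hw
      obtain ⟨u, rfl⟩ := hlift w hw
      have := h _ ((mem_accepts_prefixAutomaton a M hM n _).2 ⟨u, (hmem u).2 hw, rfl⟩)
      rwa [List.map_append, List.map_replicate, ha] at this
    · intro h w hw
      obtain ⟨u, hu, rfl⟩ := (mem_accepts_prefixAutomaton a M hM n _).1 hw
      rw [List.map_append, List.map_replicate, ha]
      exact h _ ((hmem u).1 hu)

theorem mainTheorem11 :
    ¬ HyperCFG.RegularMembershipDecidable (fun I : HyperCFG.MembershipInput =>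
      I.grammar.IsUniversal ∧ I.grammar.IsSync ∧ ∃ w, w ∈ I.language) := by
  classical
  rintro ⟨d, hd, hdI⟩
  -- The function runs the program with number `n` on input `0`; the program `zero` witnesses that
  -- it is defined somewhere.
  have hf : Partrec fun n : ℕ => (Denumerable.ofNat Nat.Partrec.Code n).eval 0 :=
    Nat.Partrec.Code.eval_part.comp (Computable.ofNat _) (Computable.const 0)
  obtain ⟨I, hI, hIf⟩ := exists_inputs_of_partrec hf
    ⟨Encodable.encode Nat.Partrec.Code.zero, by
      rw [Denumerable.ofNat_encode]
      trivial⟩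
  -- Membership means that the program does not halt, so the decision procedure for halting negates
  -- the answer.
  refine ComputablePred.halting_problem 0 (ComputablePred.computable_iff.2
    ⟨fun c => !decide ((I (Encodable.encode c)).language ∈
      (I (Encodable.encode c)).grammar.hyperlanguage), ?_, ?_⟩)
  · refine Computable.comp (Primrec.not.to_comp) ?_
    refine Partrec.of_eq (hd.comp (hI.comp Computable.encode)) fun c => ?_
    obtain ⟨h₁, h₂⟩ := hdI _ (hIf (Encodable.encode c)).1
    refine Part.eq_some_iff.2 ?_
    by_cases h : (I (Encodable.encode c)).language ∈
        (I (Encodable.encode c)).grammar.hyperlanguage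
    · simpa [h] using h₁ h
    · simpa [h] using h₂ h
  · funext c
    have := (hIf (Encodable.encode c)).2
    rw [Denumerable.ofNat_encode] at this
    simp [this]
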